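/- Let $t_0\in\mathbb R$ and let $A(t)$, $B(t)=B^*(t)$, $C(t)=C^*(t)$ be continuous complex $2\times2$ matrix functions on $[t_0,+\infty)$. Consider the hamiltonian system $$\phi'=A(t)\phi+B(t)\psi,\qquad \psi'=C(t)\phi-A^*(t)\psi,\qquad t\ge t_0, \tag{1.1}$$ and the corresponding system $\Phi'=A\Phi+B\Psi$, $\Psi'=C\Phi-A^*\Psi$ for $2\times 2$ matrix functions. A solution $(\Phi,\Psi)$ of the matrix system on $[t_0,+\infty)$ is *conjoined* if $\Phi^*\Psi=\Psi^*\Phi$ on $[t_0,+\infty)$, and *oscillatory* if $\det\Phi(t)$ has arbitrarily large zeros. System (1.1) is *oscillatory* if all conjoined solutions of the matrix system are oscillatory, and *non-oscillatory* otherwise. **Theorem 3.4.** Assume that: 1. $B(t)\ge0$ for $t\ge t_0$, and $\sqrt{B(t)}$ is continuously differentiable on $[t_0,+\infty)$; 2. the equation $$\sqrt{B(t)}\,X\,[A(t)\sqrt{B(t)}-\sqrt{B(t)}\,']=A(t)\sqrt{B(t)}-\sqrt{B(t)}\,',\qquad t\ge t_0, \tag{3.21}$$ has a solution $X=F(t)$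 on $[t_0,+\infty)$. Put $$P(t)=F(t)[A(t)\sqrt{B(t)}-\sqrt{B(t)}\,']=(p_{jk}(t))_{j,k=1}^2,\qquad Q(t)=\sqrt{B(t)}\,C(t)\sqrt{B(t)}=(q_{jk}(t))_{j,k=1}^2;$$ 3. $p_{12}$ and $p_{21}$ are continuously differentiable on $[t_0,+\infty)$, and $p_{11},p_{22}$ are integrable on every interval $[t_0,T]$; 4. for $j=1,2$ there is a sequence $t_0=\xi_{j,0}<\xi_{j,1}<\xi_{j,2}<\cdots$ tending to $+\infty$ such that $$\int_{\xi_{j,m}}^{t}\exp\Bigl\{\int_{\xi_{j,m}}^{\tau}\bigl[2\,\mathrm{Re}\,p_{jj}(s)-\widetilde I_{j+2}(\xi_{j,m},s)\bigr]ds\Bigr\}\,\widetilde\chi_{j+2}(\tau)\,d\tau\le0,\qquad t\in[\xi_{j,m},\xi_{j,m+1}),\quad m=1,2,3,\dots$$ Here, for $t\ge\xi\ge t_0$ and $t\ge\tau\ge t_0$, $$E(\tau,t)=\exp\Bigl\{-\int_\tau^t\bigl(\overline p_{11}(s)+p_{22}(s)\bigr)ds\Bigr\},\qquad \widetilde{\mathfrak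 M}(t)=\max_{\tau\in[t_0,t]}\bigl|E(\tau,t)\bigl(p_{12}(\tau)-\overline p_{21}(\tau)\bigr)\bigr|,$$ $$\widetilde\chi_3(t)=\Bigl[\widetilde{\mathfrak M}(t)+\int_{t_0}^t\bigl|E(\tau,t)\bigl[\overline p_{21}'(\tau)+\overline p_{21}(\tau)(\overline p_{11}(\tau)+p_{22}(\tau))+q_{12}(\tau)\bigr]\bigr|d\tau\Bigr]^2-|p_{21}(t)|^2-q_{11}(t),$$ $$\widetilde\chi_4(t)=\Bigl[\widetilde{\mathfrak M}(t)+\int_{t_0}^t\bigl|E(\tau,t)\bigl[p_{12}'(\tau)+p_{12}(\tau)(\overline p_{11}(\tau)+p_{22}(\tau))+q_{12}(\tau)\bigr]\bigr|d\tau\Bigr]^2-|p_{12}(t)|^2-q_{22}(t),$$ $$\widetilde I_{j+2}(\xi,t)=\int_\xi^t\exp\Bigl\{-\int_\tau^t2\,\mathrm{Re}\,p_{jj}(s)\,ds\Bigr\}\widetilde\chi_{j+2}(\tau)\,d\tau,\qquad j=1,2.$$ Then system (1.1) is non-oscillatory. -/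

import Mathlib

open MeasureTheory Set Filter
open scoped Matrix MatrixOrder ComplexOrder ComplexConjugate Topology

/-- Complex `2 × 2` matrices; index `0` (resp. `1`) is the first (resp. second) row or column. -/
abbrev Mat2 : Type := Matrix (Fin 2) (Fin 2) ℂ

namespace Ham

/-- All entries of the matrix function are continuous on `[t₀, ∞)`. -/
def ContEntries (t₀ : ℝ) (X : ℝ → Mat2) : Prop :=
  ∀ i j, ContinuousOn (fun t => X t i j) (Ici t₀)

/-- All entries of the matrix function are continuously differentiable on `[t₀, ∞)`. -/
def C1Entries (t₀ : ℝ) (X : ℝ → Mat2) : Prop :=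
  ∀ i j, ContDiffOn ℝ 1 (fun t => X t i j) (Ici t₀)

/-- The derivative `X'(t)` of a matrix function on `[t₀, ∞)`, entry by entry
(one-sided at `t₀`). -/
noncomputable def matDeriv (t₀ : ℝ) (X : ℝ → Mat2) (t : ℝ) : Mat2 :=
  Matrix.of fun i j => derivWithin (fun s => X s i j) (Ici t₀) t

/-- `(Φ, Ψ)` solves `Φ' = AΦ + BΨ`, `Ψ' = CΦ - A*Ψ` on `[t₀, ∞)`. -/
def IsMatrixSolution (t₀ : ℝ) (A B C Φ Ψ : ℝ → Mat2) : Prop :=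
  ∀ t, t₀ ≤ t → ∀ i j,
    HasDerivWithinAt (fun s => Φ s i j) ((A t * Φ t + B t * Ψ t) i j) (Ici t₀) t ∧
    HasDerivWithinAt (fun s => Ψ s i j) ((C t * Φ t - (A t)ᴴ * Ψ t) i j) (Ici t₀) t

/-- A conjoined (prepared) pair: `Φ*Ψ = Ψ*Φ` on `[t₀, ∞)`. -/
def IsConjoined (t₀ : ℝ) (Φ Ψ : ℝ → Mat2) : Prop :=
  ∀ t, t₀ ≤ t → (Φ t)ᴴ * Ψ t = (Ψ t)ᴴ * Φ t

/-- `(Φ, Ψ)` is oscillatory: `det Φ` has arbitrarily large zeros. -/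
def IsOscillatorySolution (t₀ : ℝ) (Φ : ℝ → Mat2) : Prop :=
  ∀ T : ℝ, ∃ t, T ≤ t ∧ t₀ ≤ t ∧ (Φ t).det = 0

/-- The hamiltonian system `φ' = Aφ + Bψ`, `ψ' = Cφ - A*ψ` is oscillatory: every conjoined
solution of the matrix system is oscillatory. -/
def IsOscillatory (t₀ : ℝ) (A B C : ℝ → Mat2) : Prop :=
  ∀ Φ Ψ : ℝ → Mat2, IsMatrixSolution t₀ A B C Φ Ψ → IsConjoined t₀ Φ Ψ →
    IsOscillatorySolution t₀ Φ

/-- The system is non-oscillatory: it is not oscillatory. -/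
def IsNonoscillatory (t₀ : ℝ) (A B C : ℝ → Mat2) : Prop :=
  ¬ IsOscillatory t₀ A B C

/-- The nonnegative square root `√B(t)`, for `B(t) ≥ 0`. -/
noncomputable def sqrtB (B : ℝ → Mat2) (t : ℝ) : Mat2 := CFC.sqrt (B t)

/-- `A√B - (√B)'`. -/
noncomputable def G (t₀ : ℝ) (A B : ℝ → Mat2) (t : ℝ) : Mat2 :=
  A t * sqrtB B t - matDeriv t₀ (sqrtB B) t

/-- `X = F` solves `√B X (A√B - (√B)') = A√B - (√B)'` on `[t₀, ∞)`. -/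
def SolvesFactorEq (t₀ : ℝ) (A B F : ℝ → Mat2) : Prop :=
  ∀ t, t₀ ≤ t → sqrtB B t * F t * G t₀ A B t = G t₀ A B t

/-- `P = F (A√B - (√B)')`. -/
noncomputable def P (t₀ : ℝ) (A B F : ℝ → Mat2) (t : ℝ) : Mat2 := F t * G t₀ A B t

/-- `Q = √B C √B`. -/
noncomputable def Q (B C : ℝ → Mat2) (t : ℝ) : Mat2 := sqrtB B t * C t * sqrtB B t

/-- `exp (-∫_τ^t (conj p₁₁ + p₂₂) ds)`. -/
noncomputable def kern (p : ℝ → Mat2) (τ t : ℝ) : ℂ :=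
  Complex.exp (-∫ s in τ..t, (conj (p s 0 0) + p s 1 1))

/-- `max_{τ ∈ [t₀, t]} |exp (-∫_τ^t (conj p₁₁ + p₂₂) ds) (p₁₂(τ) - conj p₂₁(τ))|`. -/
noncomputable def maj (t₀ : ℝ) (p : ℝ → Mat2) (t : ℝ) : ℝ :=
  sSup ((fun τ => ‖kern p τ t * (p τ 0 1 - conj (p τ 1 0))‖) '' Icc t₀ t)

/-- `∫_{t₀}^t |exp (-∫_τ^t (conj p₁₁ + p₂₂) ds) [w'(τ) + w(τ)(conj p₁₁ + p₂₂)(τ) + q₁₂(τ)]| dτ`. -/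
noncomputable def remInt (t₀ : ℝ) (p q : ℝ → Mat2) (w : ℝ → ℂ) (t : ℝ) : ℝ :=
  ∫ τ in t₀..t, ‖kern p τ t *
    (derivWithin w (Ici t₀) τ + w τ * (conj (p τ 0 0) + p τ 1 1) + q τ 0 1)‖

/-- The majorant `χ̃₃`. The diagonal entry `q₁₁` is real, as `Q` is Hermitian. -/
noncomputable def chi3 (t₀ : ℝ) (p q : ℝ → Mat2) (t : ℝ) : ℝ :=
  (maj t₀ p t + remInt t₀ p q (fun τ => conj (p τ 1 0)) t) ^ 2
    - ‖p t 1 0‖ ^ 2 - (q t 0 0).re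

/-- The majorant `χ̃₄`. The diagonal entry `q₂₂` is real, as `Q` is Hermitian. -/
noncomputable def chi4 (t₀ : ℝ) (p q : ℝ → Mat2) (t : ℝ) : ℝ :=
  (maj t₀ p t + remInt t₀ p q (fun τ => p τ 0 1) t) ^ 2
    - ‖p t 0 1‖ ^ 2 - (q t 1 1).re

/-- `I_{g,h}(ξ; t) = ∫_ξ^t exp (-∫_τ^t g ds) h(τ) dτ`. -/
noncomputable def I (g h : ℝ → ℝ) (ξ t : ℝ) : ℝ :=
  ∫ τ in ξ..t, Real.exp (-∫ s in τ..t, g s) * h τ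

/-- There is a sequence `t₀ = ξ₀ < ξ₁ < ξ₂ < ⋯` tending to infinity with
`∫_{ξₘ}^t exp (∫_{ξₘ}^τ [g(s) - I_{g,h}(ξₘ; s)] ds) h(τ) dτ ≤ 0`
for all `t ∈ [ξₘ, ξₘ₊₁)` and `m = 1, 2, 3, …`. -/
def SeqCond (t₀ : ℝ) (g h : ℝ → ℝ) : Prop :=
  ∃ ξ : ℕ → ℝ, ξ 0 = t₀ ∧ StrictMono ξ ∧ Tendsto ξ atTop atTop ∧
    ∀ m, 1 ≤ m → ∀ t ∈ Ico (ξ m) (ξ (m + 1)),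
      (∫ τ in (ξ m)..t, Real.exp (∫ s in (ξ m)..τ, (g s - I g h (ξ m) s)) * h τ) ≤ 0

end Ham

/-! Let `D = diag(exp ∫ p₁₁, exp ∫ p₂₂)` and `S = √B D`. Since `√B P = A√B - (√B)'`, one gets `S' =
A S - S 𝒫` with `𝒫` off-diagonal, `B = S 𝓑 S*` with `𝓑 = (D D*)⁻¹` positive diagonal, and `𝒬 = S* C
S`. Solutions of `X' = 𝒫 X + 𝓑 U`, `U' = 𝒬 X - 𝒫* U` are thus related to those of the given system
by `φ = S X`, `U = S* ψ`. The gain is that `𝓑` is invertible although `B` need not be.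

A Hermitian solution `V` of the gauged Riccati equation exists on a half-line. While its diagonal
entries `v₁`, `v₂` are nonnegative, the off-diagonal entry `w` obeys a linear equation with damping
`d₁ v₁ + d₂ v₂` (`norm_offDiag_le`), whence `‖w + β‖ ≤ R₃` and `‖w + α‖ ≤ R₄`, the radii being the
bracketed majorants up to an exponential factor. So `v₁` and `v₂` are supersolutions of scalar
Riccati equations `x' = -d x² - h`. The integral conditions supply, on each `[ξₘ, ξₘ₊₁]`, a
nonnegative subsolution vanishing at `ξₘ` (`exists_nonneg_riccati_subsolution`); comparison,
restarted at every node, keeps `v₁` and `v₂` positive (`diag_pos`). Then `|det X|` cannot decrease,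
and `V = U X⁻¹` never blows up (`exists_global_riccati`).

To return to the given system, start a conjoined solution from `Φ(T) = 1`, `Ψ(T) = r`. If `Φ(s) v =
0`, the solution `(Φ v, Ψ v)` lifts to the gauged system with `X(s) = 0` (`exists_lift`), and
Picone's identity makes `X*(U - V X)` nondecreasing, which is impossible if `r |S x|²` dominates `x*
V x` at `T`. When `S` is singular this domination can fail along `ker S`; it is restored by
following a kernel solution `k' = 𝒫 k` and distinguishing the sign of the nonincreasing function `k*
V k` (`hasNonsingularConjoined`). -/

/-! ### Lipschitz and linear differential equations. -/

/-- Global solvability of the Cauchy problem for a time-dependent Lipschitz vector field with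
continuous Lipschitz constant. -/
theorem exists_global_solution_of_lipschitz {E : Type*} [NormedAddCommGroup E] [NormedSpace ℝ E]
    [CompleteSpace E] (f : ℝ → E → E) (m : ℝ → ℝ) (hm : Continuous m) (hm0 : ∀ t, 0 ≤ m t)
    (hf : Continuous (Function.uncurry f))
    (hlip : ∀ t x y, ‖f t x - f t y‖ ≤ m t * ‖x - y‖) (h0 : ∀ t, f t 0 = 0) (T : ℝ) (x₀ : E) :
    ∃ x : ℝ → E, x T = x₀ ∧ ∀ t, HasDerivAt x (f t (x t)) t := by
  set u : ℝ → ℝ := fun t => ∫ s in T..t, m s with hu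
  have hud : ∀ t, HasDerivAt u (m t) t := fun t =>
    intervalIntegral.integral_hasDerivAt_right (hm.intervalIntegrable _ _)
      hm.aestronglyMeasurable.stronglyMeasurableAtFilter hm.continuousAt
  have huc : Continuous u := continuous_iff_continuousAt.2 fun t => (hud t).continuousAt
  -- Picard iteration in a weighted sup norm, writing `x = W y` with `y` bounded. The weight
  -- satisfies `|∫ W m| ≤ W / 2` on both sides of `T`, so the integral operator contracts by `1 / 2`
  -- on the whole line.
  set W : ℝ → ℝ := fun t => Real.cosh (2 * u t) with hW
  have hWc : Continuous W := Real.continuous_cosh.comp (continuous_const.mul huc)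
  have hW1 : ∀ t, 1 ≤ W t := fun t => Real.one_le_cosh _
  have hW0 : ∀ t, 0 < W t := fun t => Real.cosh_pos _
  have hWint : ∀ t, |∫ s in T..t, W s * m s| ≤ W t / 2 := by
    intro t
    have h1 : ∀ s, HasDerivAt (fun s => Real.sinh (2 * u s) / 2) (W s * m s) s := by
      intro s
      have := (((hud s).const_mul 2).sinh).div_const 2
      exact this.congr_deriv (by simp only [hW]; ring)
    rw [intervalIntegral.integral_eq_sub_of_hasDerivAt (fun s _ => h1 s)
      ((hWc.mul hm).intervalIntegrable _ _)]
    have : u T = 0 := by simp [hu]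
    simp only [this, mul_zero, Real.sinh_zero, zero_div, sub_zero, abs_div, Nat.abs_ofNat]
    have h2 : |Real.sinh (2 * u t)| ≤ W t := by
      rw [Real.abs_sinh, hW]
      simp only
      rw [← Real.cosh_abs]
      exact (Real.sinh_lt_cosh _).le
    linarith
  have hcont : ∀ y : BoundedContinuousFunction ℝ E, Continuous fun s => f s (W s • y s) :=
    fun y => hf.comp (continuous_id.prodMk (hWc.smul y.continuous))
  have hInt : ∀ y : BoundedContinuousFunction ℝ E,
      Continuous fun t => ∫ s in T..t, f s (W s • y s) := fun y =>
    intervalIntegral.continuous_primitive (fun a b => (hcont y).intervalIntegrable a b) T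
  have hdiff : ∀ (y z : BoundedContinuousFunction ℝ E) (t : ℝ),
      ‖(∫ s in T..t, f s (W s • y s)) - ∫ s in T..t, f s (W s • z s)‖ ≤ W t / 2 * dist y z := by
    intro y z t
    rw [← intervalIntegral.integral_sub ((hcont y).intervalIntegrable _ _)
      ((hcont z).intervalIntegrable _ _)]
    have h1 : ∀ s, ‖f s (W s • y s) - f s (W s • z s)‖ ≤ dist y z * (W s * m s) := by
      intro s
      refine (hlip _ _ _).trans ?_
      rw [← smul_sub, norm_smul, Real.norm_of_nonneg (hW0 s).le, ← dist_eq_norm]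
      have := y.dist_coe_le_dist (g := z) s
      have h3 : 0 ≤ W s * m s := mul_nonneg (hW0 s).le (hm0 s)
      nlinarith
    refine (intervalIntegral.norm_integral_le_abs_of_norm_le (Eventually.of_forall fun s => h1 s)
      ((continuous_const.mul (hWc.mul hm)).intervalIntegrable _ _)).trans ?_
    rw [intervalIntegral.integral_const_mul, abs_mul, abs_of_nonneg dist_nonneg, mul_comm]
    exact mul_le_mul_of_nonneg_right (hWint t) dist_nonneg
  have hz : ∀ t, (∫ s in T..t, f s (W s • (0 : BoundedContinuousFunction ℝ E) s)) = 0 := by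
    intro t; simp [h0]
  have hbd : ∀ (y : BoundedContinuousFunction ℝ E) (t : ℝ),
      ‖(W t)⁻¹ • (x₀ + ∫ s in T..t, f s (W s • y s))‖ ≤ ‖x₀‖ + dist y 0 / 2 := by
    intro y t
    have h1 := hdiff y 0 t
    rw [hz, sub_zero] at h1
    rw [norm_smul, norm_inv, Real.norm_of_nonneg (hW0 t).le, inv_mul_le_iff₀ (hW0 t)]
    refine (norm_add_le _ _).trans ?_
    nlinarith [norm_nonneg x₀, hW1 t]
  let Φ : BoundedContinuousFunction ℝ E → BoundedContinuousFunction ℝ E := fun y =>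
    BoundedContinuousFunction.ofNormedAddCommGroup
      (fun t => (W t)⁻¹ • (x₀ + ∫ s in T..t, f s (W s • y s)))
      ((hWc.inv₀ fun t => (hW0 t).ne').smul (continuous_const.add (hInt y))) _ (hbd y)
  have hΦ : ContractingWith (1 / 2) Φ := by
    refine ⟨by norm_num, LipschitzWith.of_dist_le_mul fun y z => ?_⟩
    refine (BoundedContinuousFunction.dist_le (by positivity)).2 fun t => ?_
    change dist ((W t)⁻¹ • (x₀ + ∫ s in T..t, f s (W s • y s)))
      ((W t)⁻¹ • (x₀ + ∫ s in T..t, f s (W s • z s))) ≤ _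
    rw [dist_eq_norm, ← smul_sub, add_sub_add_left_eq_sub, norm_smul, norm_inv,
      Real.norm_of_nonneg (hW0 t).le, inv_mul_le_iff₀ (hW0 t)]
    refine (hdiff y z t).trans (le_of_eq ?_)
    push_cast; ring
  set y := hΦ.fixedPoint Φ
  have hy : Φ y = y := hΦ.fixedPoint_isFixedPt
  have hx : ∀ t, W t • y t = x₀ + ∫ s in T..t, f s (W s • y s) := by
    intro t
    have : (Φ y) t = (W t)⁻¹ • (x₀ + ∫ s in T..t, f s (W s • y s)) := rfl
    rw [hy] at this
    rw [this, smul_inv_smul₀ (hW0 t).ne']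
  refine ⟨fun t => W t • y t, (hx T).trans (by simp), fun t => ?_⟩
  have h1 : HasDerivAt (fun t => x₀ + ∫ s in T..t, f s (W s • y s)) (f t (W t • y t)) t :=
    (intervalIntegral.integral_hasDerivAt_right ((hcont y).intervalIntegrable _ _)
      (hcont y).aestronglyMeasurable.stronglyMeasurableAtFilter (hcont y).continuousAt).const_add _
  exact h1.congr_of_eventuallyEq (Eventually.of_forall hx)

section LinearSystem

variable {ι : Type*} [Fintype ι]

/-- The sum of the norms of the entries. -/
noncomputable def entryNormSum (M : Matrix ι ι ℂ) : ℝ := ∑ i, ∑ j, ‖M i j‖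

theorem entryNormSum_nonneg (M : Matrix ι ι ℂ) : 0 ≤ entryNormSum M :=
  Finset.sum_nonneg fun _ _ => Finset.sum_nonneg fun _ _ => norm_nonneg _

theorem norm_mulVec_le (M : Matrix ι ι ℂ) (x : ι → ℂ) : ‖M *ᵥ x‖ ≤ entryNormSum M * ‖x‖ := by
  refine (pi_norm_le_iff_of_nonneg (mul_nonneg (entryNormSum_nonneg M) (norm_nonneg x))).2
    fun i => ?_
  rw [Matrix.mulVec, dotProduct, entryNormSum, Finset.sum_mul]
  refine (norm_sum_le _ _).trans ?_
  refine le_trans ?_ (Finset.single_le_sum (f := fun i => (∑ j, ‖M i j‖) * ‖x‖)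
    (fun i _ => by positivity) (Finset.mem_univ i))
  rw [Finset.sum_mul]
  refine Finset.sum_le_sum fun j _ => ?_
  rw [norm_mul]
  exact mul_le_mul_of_nonneg_left (norm_le_pi_norm x j) (norm_nonneg _)

theorem continuous_entryNormSum {M : ℝ → Matrix ι ι ℂ} (hM : ∀ i j, Continuous fun t => M t i j) :
    Continuous fun t => entryNormSum (M t) :=
  continuous_finsetSum _ fun i _ => continuous_finsetSum _ fun j _ => (hM i j).norm

theorem norm_mulVec_sub_le (M : Matrix ι ι ℂ) (x y : ι → ℂ) :
    ‖M *ᵥ x - M *ᵥ y‖ ≤ entryNormSum M * ‖x - y‖ := by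
  rw [← Matrix.mulVec_sub]; exact norm_mulVec_le M _

/-- Global solvability of a linear system with continuous coefficients. -/
theorem exists_linear_solution (M : ℝ → Matrix ι ι ℂ) (hM : ∀ i j, Continuous fun t => M t i j)
    (T : ℝ) (x₀ : ι → ℂ) :
    ∃ x : ℝ → ι → ℂ, x T = x₀ ∧ ∀ t i, HasDerivAt (fun s => x s i) ((M t *ᵥ x t) i) t := by
  obtain ⟨x, hx0, hx⟩ := exists_global_solution_of_lipschitz (fun t x => M t *ᵥ x)
    (fun t => entryNormSum (M t)) (continuous_entryNormSum hM) (fun t => entryNormSum_nonneg _)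
    (by
      refine continuous_pi fun i => ?_
      simp only [Function.uncurry, Matrix.mulVec, dotProduct]
      exact continuous_finsetSum _ fun j _ => ((hM i j).comp continuous_fst).mul
        ((continuous_apply j).comp continuous_snd))
    (fun t x y => norm_mulVec_sub_le _ _ _) (fun t => Matrix.mulVec_zero _) T x₀
  exact ⟨x, hx0, fun t i => hasDerivAt_pi.1 (hx t) i⟩

/-- A solution of a linear system with continuous coefficients that vanishes at one point of
an interval vanishes on the interval. -/
theorem linear_solution_eq_zero {M : ℝ → Matrix ι ι ℂ} (hM : ∀ i j, Continuous fun t => M t i j)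
    {x : ℝ → ι → ℂ} {a b : ℝ}
    (hx : ∀ t ∈ Icc a b, ∀ i, HasDerivAt (fun s => x s i) ((M t *ᵥ x t) i) t)
    {c : ℝ} (hc : c ∈ Icc a b) (hxc : x c = 0) : ∀ t ∈ Icc a b, x t = 0 := by
  obtain ⟨K, hK⟩ := isCompact_Icc.exists_bound_of_continuousOn (s := Icc a b)
    (continuous_entryNormSum hM).continuousOn
  have hx' : ∀ t ∈ Icc a b, HasDerivAt x (M t *ᵥ x t) t := fun t ht => hasDerivAt_pi.2 (hx t ht)
  have hxcont : ContinuousOn x (Icc a b) := fun t ht => (hx' t ht).continuousAt.continuousWithinAt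
  have hlip : ∀ t ∈ Icc a b, LipschitzOnWith K.toNNReal (fun y => M t *ᵥ y) univ := by
    intro t ht
    refine LipschitzOnWith.of_dist_le_mul fun y _ z _ => ?_
    rw [dist_eq_norm, dist_eq_norm]
    refine (norm_mulVec_sub_le _ _ _).trans (mul_le_mul_of_nonneg_right ?_ (norm_nonneg _))
    exact ((le_abs_self _).trans (hK t ht)).trans (Real.le_coe_toNNReal K)
  have hzero : ∀ t, HasDerivAt (fun _ : ℝ => (0 : ι → ℂ)) (M t *ᵥ 0) t := fun t => by
    rw [Matrix.mulVec_zero]; exact hasDerivAt_const _ _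
  have hr : EqOn x (fun _ => 0) (Icc c b) := by
    have hs : Icc c b ⊆ Icc a b := Icc_subset_Icc_left hc.1
    exact ODE_solution_unique_of_mem_Icc_right (v := fun t y => M t *ᵥ y) (s := fun _ => univ)
      (fun t ht => hlip t (hs (Ico_subset_Icc_self ht))) (hxcont.mono hs)
      (fun t ht => (hx' t (hs (Ico_subset_Icc_self ht))).hasDerivWithinAt) (fun _ _ => mem_univ _)
      continuousOn_const (fun t _ => (hzero t).hasDerivWithinAt) (fun _ _ => mem_univ _) hxc
  have hl : EqOn x (fun _ => 0) (Icc a c) := by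
    have hs : Icc a c ⊆ Icc a b := Icc_subset_Icc_right hc.2
    exact ODE_solution_unique_of_mem_Icc_left (v := fun t y => M t *ᵥ y) (s := fun _ => univ)
      (fun t ht => hlip t (hs (Ioc_subset_Icc_self ht))) (hxcont.mono hs)
      (fun t ht => (hx' t (hs (Ioc_subset_Icc_self ht))).hasDerivWithinAt) (fun _ _ => mem_univ _)
      continuousOn_const (fun t _ => (hzero t).hasDerivWithinAt) (fun _ _ => mem_univ _) hxc
  intro t ht
  rcases le_total c t with h | h
  · exact hr ⟨h, ht.2⟩
  · exact hl ⟨ht.1, h⟩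

end LinearSystem

/-! ### Scalar inequalities: damping, Riccati comparison, subsolutions. -/

/-- A ball of radius `R` is invariant for `Y' = -s Y + b` when `‖b‖ ≤ s R` and `0 ≤ s`. -/
theorem norm_le_of_damped {Y b : ℝ → ℂ} {s : ℝ → ℝ} {a c R : ℝ} (hac : a ≤ c) (hR : 0 ≤ R)
    (hYc : ContinuousOn Y (Icc a c))
    (hY : ∀ t ∈ Ico a c, HasDerivAt Y (-(s t : ℂ) * Y t + b t) t)
    (hs : ∀ t ∈ Ico a c, 0 ≤ s t) (hb : ∀ t ∈ Ico a c, ‖b t‖ ≤ s t * R) (ha : ‖Y a‖ ≤ R) :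
    ‖Y c‖ ≤ R := by
  refine le_of_forall_pos_le_add fun ε hε => ?_
  -- The radius is inflated to `R + δ (1 + (t - a))`: the barrier grows strictly, while the field
  -- does not point outwards where the barrier is touched. At `t = c` the inflation is exactly `ε`.
  set δ := ε / (1 + (c - a)) with hδ
  have hca : 0 ≤ c - a := sub_nonneg.2 hac
  have hδ0 : 0 < δ := by positivity
  have key : ∀ t ∈ Icc a c, ‖Y t‖ ^ 2 ≤ (R + δ * (1 + (t - a))) ^ 2 := by
    intro t ht
    refine image_le_of_deriv_right_lt_deriv_boundary' (f := fun t => ‖Y t‖ ^ 2)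
      (f' := fun t => 2 * inner ℝ (Y t) (-(s t : ℂ) * Y t + b t))
      (B := fun t => (R + δ * (1 + (t - a))) ^ 2)
      (B' := fun t => 2 * (R + δ * (1 + (t - a))) * δ) (hYc.norm.pow 2) ?_ ?_ ?_ ?_ ?_ ht
    · exact fun x hx => (hY x hx).hasDerivWithinAt.norm_sq
    · simp only [sub_self, add_zero, mul_one]
      exact pow_le_pow_left₀ (norm_nonneg _) (by linarith) 2
    · fun_prop
    · intro x _
      have h1 : HasDerivAt (fun t : ℝ => R + δ * (1 + (t - a))) δ x := by
        simpa using ((((hasDerivAt_id x).sub_const a).const_add 1).const_mul δ).const_add R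
      have h2 := h1.pow 2
      exact (h2.congr_deriv (by simp)).hasDerivWithinAt
    · intro x hx hxe
      have hB : 0 < R + δ * (1 + (x - a)) := by
        have := sub_nonneg.2 hx.1
        positivity
      have hn : ‖Y x‖ = R + δ * (1 + (x - a)) :=
        (pow_left_inj₀ (norm_nonneg _) hB.le two_ne_zero).1 hxe
      have h1 : inner ℝ (Y x) (-(s x : ℂ) * Y x + b x) ≤ 0 := by
        have e1 : -(s x : ℂ) * Y x = (-(s x)) • Y x := by
          rw [Complex.real_smul]; push_cast; ring
        rw [inner_add_right, e1, real_inner_smul_right, real_inner_self_eq_norm_sq]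
        have h3 := real_inner_le_norm (Y x) (b x)
        have h4 : ‖Y x‖ * ‖b x‖ ≤ ‖Y x‖ * (s x * R) :=
          mul_le_mul_of_nonneg_left (hb x hx) (norm_nonneg _)
        have h5 : R ≤ ‖Y x‖ := by
          rw [hn]
          have := sub_nonneg.2 hx.1
          have : 0 ≤ δ * (1 + (x - a)) := by positivity
          linarith
        have h6 : 0 ≤ s x * ‖Y x‖ * (‖Y x‖ - R) :=
          mul_nonneg (mul_nonneg (hs x hx) (norm_nonneg _)) (sub_nonneg.2 h5)
        nlinarith
      have : 0 < 2 * (R + δ * (1 + (x - a))) * δ := by positivity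
      linarith
  have hc := key c ⟨hac, le_rfl⟩
  have hB : 0 ≤ R + δ * (1 + (c - a)) := by positivity
  have := (pow_le_pow_iff_left₀ (norm_nonneg _) hB two_ne_zero).1 hc
  rwa [hδ, div_mul_cancel₀ _ (by positivity)] at this

/-- Strict comparison of a supersolution `v` and a subsolution `z` of `x' = -d x² - h`. -/
theorem riccati_strict_comparison {v z v' z' d h : ℝ → ℝ} {a b : ℝ}
    (hd : ContinuousOn d (Icc a b)) (hvc : ContinuousOn v (Icc a b))
    (hzc : ContinuousOn z (Icc a b))
    (hv : ∀ t ∈ Ico a b, HasDerivAt v (v' t) t) (hz : ∀ t ∈ Ico a b, HasDerivAt z (z' t) t)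
    (hv' : ∀ t ∈ Ico a b, -d t * v t ^ 2 - h t ≤ v' t)
    (hz' : ∀ t ∈ Ico a b, z' t ≤ -d t * z t ^ 2 - h t) (hab : z a < v a) :
    ∀ t ∈ Icc a b, z t < v t := by
  -- At a contact `v = z + e` the difference of the derivatives is at most `d (v² - z²) = d (v + z)
  -- e ≤ K e`, strictly less than the slope `(K + 1) e` of the barrier.
  obtain ⟨K, hK⟩ := isCompact_Icc.exists_bound_of_continuousOn (hd.mul (hvc.add hzc))
  set ε := v a - z a with hε
  have hε0 : 0 < ε := sub_pos.2 hab
  have key : ∀ t ∈ Icc a b, z t - v t ≤ -(ε * Real.exp (-(K + 1) * (t - a))) := by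
    intro t ht
    refine image_le_of_deriv_right_lt_deriv_boundary' (f := fun t => z t - v t)
      (f' := fun t => z' t - v' t)
      (B := fun t => -(ε * Real.exp (-(K + 1) * (t - a))))
      (B' := fun t => (K + 1) * (ε * Real.exp (-(K + 1) * (t - a)))) (hzc.sub hvc) ?_ ?_ ?_ ?_ ?_ ht
    · exact fun x hx => ((hz x hx).sub (hv x hx)).hasDerivWithinAt
    · simp [hε]
    · fun_prop
    · intro x _
      have h1 : HasDerivAt (fun t : ℝ => -(K + 1) * (t - a)) (-(K + 1)) x := by
        simpa using ((hasDerivAt_id x).sub_const a).const_mul (-(K + 1))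
      have h2 := (h1.exp.const_mul ε).neg
      exact (h2.congr_deriv (by ring)).hasDerivWithinAt
    · intro x hx hxe
      have hE : 0 < ε * Real.exp (-(K + 1) * (x - a)) := by positivity
      set e := ε * Real.exp (-(K + 1) * (x - a))
      have h1 := hv' x hx
      have h2 := hz' x hx
      have h3 : d x * (v x + z x) ≤ K := (le_abs_self _).trans (hK x (Ico_subset_Icc_self hx))
      have h4 : v x = z x + e := by linarith
      have h5 : d x * (v x + z x) * e ≤ K * e := mul_le_mul_of_nonneg_right h3 hE.le
      have h6 : d x * v x ^ 2 - d x * z x ^ 2 = d x * (v x + z x) * e := by rw [h4]; ring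
      linarith
  intro t ht
  have h1 := key t ht
  have : 0 < ε * Real.exp (-(K + 1) * (t - a)) := by positivity
  linarith

/-- If `-∫ exp(-∫ d J) h ≥ 0` with `J = ∫ h`, then `x' = -d x² - h` has a nonnegative subsolution
vanishing at the left end. -/
theorem exists_nonneg_riccati_subsolution {d h : ℝ → ℝ} (hd : Continuous d) (hh : Continuous h)
    (hd0 : ∀ t, 0 ≤ d t) {a b : ℝ} (hab : a < b)
    (hcond : ∀ t ∈ Ico a b, ∫ τ in a..t, Real.exp (-∫ s in a..τ, d s * ∫ r in a..s, h r) * h τ ≤ 0) :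
    ∃ z z' : ℝ → ℝ, z a = 0 ∧ (∀ t, HasDerivAt z (z' t) t) ∧
      ∀ t ∈ Icc a b, 0 ≤ z t ∧ z' t ≤ -d t * z t ^ 2 - h t := by
  have prim : ∀ {f : ℝ → ℝ}, Continuous f → ∀ t, HasDerivAt (fun t => ∫ s in a..t, f s) (f t) t :=
    fun {f} hf t => intervalIntegral.integral_hasDerivAt_right (hf.intervalIntegrable _ _)
      hf.aestronglyMeasurable.stronglyMeasurableAtFilter hf.continuousAt
  have primc : ∀ {f : ℝ → ℝ}, Continuous f → Continuous fun t => ∫ s in a..t, f s :=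
    fun {f} hf => continuous_iff_continuousAt.2 fun t => (prim hf t).continuousAt
  set J : ℝ → ℝ := fun t => ∫ r in a..t, h r with hJ
  have hJc : Continuous J := primc hh
  set L : ℝ → ℝ := fun t => ∫ s in a..t, d s * J s with hL
  have hdJ : Continuous fun s => d s * J s := hd.mul hJc
  have hLc : Continuous L := primc hdJ
  have hgc : Continuous fun τ => Real.exp (-L τ) * h τ := (hLc.neg.rexp).mul hh
  set Z : ℝ → ℝ := fun t => ∫ τ in a..t, Real.exp (-L τ) * h τ with hZ
  have hZc : Continuous Z := primc hgc
  have hZ0 : ∀ t ∈ Icc a b, Z t ≤ 0 := by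
    intro t ht
    have : Icc a b ⊆ closure (Ico a b) := by rw [closure_Ico hab.ne]
    exact closure_minimal (s := Ico a b) (t := {t | Z t ≤ 0}) (fun t ht => hcond t ht)
      (isClosed_le hZc continuous_const) (this ht)
  -- `z` solves the linear equation `z' = d J z - h`, so it is a Riccati subsolution wherever `0 ≤ z
  -- ≤ -J`.
  set z : ℝ → ℝ := fun t => -(Real.exp (L t) * Z t) with hz
  have hzd : ∀ t, HasDerivAt z (d t * J t * z t - h t) t := by
    intro t
    have h1 := (((prim hdJ t).exp).mul (prim hgc t)).neg
    refine h1.congr_deriv ?_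
    change -(Real.exp (L t) * (d t * J t) * Z t + Real.exp (L t) * (Real.exp (-L t) * h t)) =
      d t * J t * -(Real.exp (L t) * Z t) - h t
    have : Real.exp (L t) * Real.exp (-L t) = 1 := by rw [← Real.exp_add]; simp
    linear_combination (-h t) * this
  have hz0 : ∀ t ∈ Icc a b, 0 ≤ z t := fun t ht => by
    have := mul_nonneg (Real.exp_nonneg (L t)) (neg_nonneg.2 (hZ0 t ht))
    simp only [hz]; linarith
  have hzc : Continuous z := continuous_iff_continuousAt.2 fun t => (hzd t).continuousAt
  -- `D = -J - z` satisfies `D' = -d J z`, hence `D' = d z D + d z²` and `D ≥ 0`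
  set M : ℝ → ℝ := fun t => ∫ s in a..t, d s * z s with hM
  have hdz : Continuous fun s => d s * z s := hd.mul hzc
  have hDd : ∀ t, HasDerivAt (fun t => Real.exp (-M t) * (-J t - z t))
      (Real.exp (-M t) * (d t * z t ^ 2)) t := by
    intro t
    have h1 := ((prim hdz t).neg.exp).mul ((prim hh t).neg.sub (hzd t))
    refine h1.congr_deriv ?_
    change Real.exp (-M t) * -(d t * z t) * (-J t - z t) +
      Real.exp (-M t) * (-h t - (d t * J t * z t - h t)) = _
    ring
  have hD : ∀ t ∈ Icc a b, z t ≤ -J t := by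
    have hmono : Monotone fun t => Real.exp (-M t) * (-J t - z t) :=
      monotone_of_hasDerivAt_nonneg hDd fun t => by
        have := hd0 t
        positivity
    intro t ht
    have h1 := hmono ht.1
    have h2 : J a = 0 := by simp [hJ]
    have h3 : z a = 0 := by simp [hz, hZ]
    simp only [h2, h3, neg_zero, sub_zero, mul_zero] at h1
    have := nonneg_of_mul_nonneg_right h1 (Real.exp_pos _)
    linarith
  refine ⟨z, fun t => d t * J t * z t - h t, by simp [hz, hZ], hzd, fun t ht => ⟨hz0 t ht, ?_⟩⟩
  have h1 := hD t ht
  have h2 := mul_nonneg (mul_nonneg (hd0 t) (hz0 t ht)) (sub_nonneg.2 h1)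
  nlinarith

/-- Every supersolution of `x' = -d x² - h` on a right neighbourhood of `T` that starts above some
threshold stays positive. -/
def PositivityPersists (T : ℝ) (d h : ℝ → ℝ) : Prop :=
  ∃ x₀ : ℝ, ∀ (b : ℝ) (v v' : ℝ → ℝ), T ≤ b → ContinuousOn v (Icc T b) →
    (∀ t ∈ Ico T b, HasDerivAt v (v' t) t) → (∀ t ∈ Ico T b, -d t * v t ^ 2 - h t ≤ v' t) →
    x₀ < v T → 0 < v b

/-- The threshold is the value at `T` of the subsolution on the interval containing `T`. On reaching
a node the old subsolution is still nonnegative, so `v` is positive there and lies strictly above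
the next subsolution, which starts from zero. -/
theorem positivityPersists_of_subsolutions {d h : ℝ → ℝ} (hd : Continuous d) {ξ : ℕ → ℝ}
    (hξ : StrictMono ξ) (hξt : Tendsto ξ atTop atTop) {z z' : ℕ → ℝ → ℝ}
    (hz0 : ∀ m, 1 ≤ m → z m (ξ m) = 0) (hz : ∀ m, 1 ≤ m → ∀ t, HasDerivAt (z m) (z' m t) t)
    (hz' : ∀ m, 1 ≤ m → ∀ t ∈ Icc (ξ m) (ξ (m + 1)),
      0 ≤ z m t ∧ z' m t ≤ -d t * z m t ^ 2 - h t) {T : ℝ} (hT : ξ 1 ≤ T) :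
    PositivityPersists T d h := by
  obtain ⟨m, hm1, hmT, hTm⟩ : ∃ m, 1 ≤ m ∧ ξ m ≤ T ∧ T < ξ (m + 1) := by
    have hex : ∃ n, T < ξ n := (hξt.eventually_gt_atTop T).exists
    classical
    have h1 := Nat.find_spec hex
    have h2 : 1 < Nat.find hex := by
      by_contra hcon
      have := hξ.monotone (not_lt.1 hcon)
      linarith
    refine ⟨Nat.find hex - 1, by omega, ?_, ?_⟩
    · exact not_lt.1 (Nat.find_min hex (by omega))
    · rwa [Nat.sub_add_cancel (by omega)]
  refine ⟨z m T, fun b v v' hTb hvc hv hv' hvT => ?_⟩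
  have comp : ∀ n, 1 ≤ n → ∀ a c, a ≤ c → T ≤ a → c ≤ b → ξ n ≤ a → c ≤ ξ (n + 1) →
      z n a < v a → z n c < v c := by
    intro n hn a c hac hTa hcb hna hcn hlt
    have hsub : Icc a c ⊆ Icc T b := Icc_subset_Icc hTa hcb
    have hsub' : ∀ t ∈ Ico a c, t ∈ Ico T b := fun t ht => ⟨hTa.trans ht.1, ht.2.trans_le hcb⟩
    have hsub'' : ∀ t ∈ Ico a c, t ∈ Icc (ξ n) (ξ (n + 1)) := fun t ht =>
      ⟨hna.trans ht.1, (ht.2.le.trans hcn)⟩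
    exact riccati_strict_comparison hd.continuousOn (hvc.mono hsub)
      (fun t _ => (hz n hn t).continuousAt.continuousWithinAt) (fun t ht => hv t (hsub' t ht))
      (fun t _ => hz n hn t) (fun t ht => hv' t (hsub' t ht))
      (fun t ht => (hz' n hn t (hsub'' t ht)).2) hlt c ⟨hac, le_rfl⟩
  have key : ∀ n, m ≤ n → ∀ t, T ≤ t → ξ n ≤ t → t ≤ ξ (n + 1) → t ≤ b → z n t < v t := by
    intro n hn
    induction n, hn using Nat.le_induction with
    | base => exact fun t hTt _ ht htb => comp m hm1 T t hTt le_rfl htb hmT ht hvT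
    | succ n hn ih =>
      intro t _ hnt ht htb
      have hlt : ξ n < ξ (n + 1) := hξ n.lt_succ_self
      have hTn : T ≤ ξ (n + 1) := hTm.le.trans (hξ.monotone (by omega))
      have h1 := ih (ξ (n + 1)) hTn hlt.le le_rfl (hnt.trans htb)
      refine comp (n + 1) (by omega) (ξ (n + 1)) t hnt hTn htb le_rfl ht ?_
      rw [hz0 (n + 1) (by omega)]
      exact ((hz' n (by omega) _ ⟨hlt.le, le_rfl⟩).1).trans_lt h1
  obtain ⟨n, hn⟩ : ∃ n, b < ξ (n + 1) :=
    (((tendsto_add_atTop_iff_nat 1).2 hξt).eventually_gt_atTop b).exists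
  have hex : ∃ n, b < ξ (n + 1) := ⟨n, hn⟩
  classical
  have h1 := Nat.find_spec hex
  set N := Nat.find hex
  have hmN : m ≤ N := by
    by_contra hcon
    have : ξ (N + 1) ≤ ξ m := hξ.monotone (by omega)
    linarith
  have hNb : ξ N ≤ b := by
    rcases hmN.eq_or_lt with h | h
    · rw [← h]; exact hmT.trans hTb
    · have := not_lt.1 (Nat.find_min hex (m := N - 1) (by omega))
      rwa [Nat.sub_add_cancel (by omega)] at this
  exact ((hz' N (hm1.trans hmN) b ⟨hNb, h1.le⟩).1).trans_lt (key N hmN b hTb hNb h1.le le_rfl)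

/-! ### Matrix hamiltonian systems and the Riccati equation. -/

/-- Entrywise derivative of a matrix function. -/
def HasMatDeriv {m n : Type*} (X : ℝ → Matrix m n ℂ) (X' : Matrix m n ℂ) (t : ℝ) : Prop :=
  ∀ i j, HasDerivAt (fun s => X s i j) (X' i j) t

namespace HasMatDeriv

variable {l m n : Type*} {t : ℝ}

theorem congr_deriv {X : ℝ → Matrix m n ℂ} {X' X'' : Matrix m n ℂ} (h : HasMatDeriv X X' t)
    (e : X' = X'') : HasMatDeriv X X'' t := e ▸ h

theorem sub {X Y : ℝ → Matrix m n ℂ} {X' Y' : Matrix m n ℂ} (hX : HasMatDeriv X X' t)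
    (hY : HasMatDeriv Y Y' t) : HasMatDeriv (fun s => X s - Y s) (X' - Y') t :=
  fun i j => (hX i j).sub (hY i j)

theorem mul [Fintype m] {X : ℝ → Matrix l m ℂ} {Y : ℝ → Matrix m n ℂ} {X' : Matrix l m ℂ}
    {Y' : Matrix m n ℂ} (hX : HasMatDeriv X X' t) (hY : HasMatDeriv Y Y' t) :
    HasMatDeriv (fun s => X s * Y s) (X' * Y t + X t * Y') t := by
  intro i j
  simp only [Matrix.mul_apply, Matrix.add_apply, ← Finset.sum_add_distrib]
  exact HasDerivAt.fun_sum fun k _ => (hX i k).mul (hY k j)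

theorem conjTranspose {X : ℝ → Matrix m n ℂ} {X' : Matrix m n ℂ} (hX : HasMatDeriv X X' t) :
    HasMatDeriv (fun s => (X s)ᴴ) X'ᴴ t :=
  fun i j => (hX j i).star

theorem unique {X : ℝ → Matrix m n ℂ} {X' X'' : Matrix m n ℂ} (h : HasMatDeriv X X' t)
    (h' : HasMatDeriv X X'' t) : X' = X'' := by
  ext i j; exact (h i j).unique (h' i j)

theorem congr_of_eventuallyEq {X Y : ℝ → Matrix m n ℂ} {X' : Matrix m n ℂ}
    (h : HasMatDeriv X X' t) (e : Y =ᶠ[𝓝 t] X) : HasMatDeriv Y X' t :=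
  fun i j => (h i j).congr_of_eventuallyEq (e.mono fun s hs => by simp only [hs])

theorem const (M : Matrix m n ℂ) : HasMatDeriv (fun _ => M) 0 t := fun _ _ => hasDerivAt_const _ _

theorem det {X : ℝ → Mat2} {X' : Mat2} (hX : HasMatDeriv X X' t) :
    HasDerivAt (fun s => (X s).det)
      (X' 0 0 * X t 1 1 + X t 0 0 * X' 1 1 - (X' 0 1 * X t 1 0 + X t 0 1 * X' 1 0)) t := by
  simp only [Matrix.det_fin_two]
  exact ((hX 0 0).mul (hX 1 1)).sub ((hX 0 1).mul (hX 1 0))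

/-- The adjugate formula is used only for differentiability; the value of the derivative comes from
differentiating `X⁻¹ X = 1`. -/
theorem inv {X : ℝ → Mat2} {X' : Mat2} (hX : HasMatDeriv X X' t) (h0 : (X t).det ≠ 0) :
    HasMatDeriv (fun s => (X s)⁻¹) (-((X t)⁻¹ * X' * (X t)⁻¹)) t := by
  have hdet := hX.det
  have hadj : ∃ Y', HasMatDeriv (fun s => (X s).adjugate) Y' t := by
    refine ⟨!![X' 1 1, -X' 0 1; -X' 1 0, X' 0 0], fun i j => ?_⟩
    simp only [Matrix.adjugate_fin_two]
    fin_cases i <;> fin_cases j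
    · exact hX 1 1
    · exact (hX 0 1).neg
    · exact (hX 1 0).neg
    · exact hX 0 0
  obtain ⟨Y', hY'⟩ := hadj
  have hinv : ∀ i j, ∃ z, HasDerivAt (fun s => (X s)⁻¹ i j) z t := by
    intro i j
    simp only [Matrix.inv_def, Ring.inverse_eq_inv, Matrix.smul_apply, smul_eq_mul]
    exact ⟨_, (hdet.inv h0).mul (hY' i j)⟩
  choose Z' hZ' using hinv
  replace hZ' : HasMatDeriv (fun s => (X s)⁻¹) (Matrix.of Z') t := hZ'
  have h1 := hZ'.mul hX
  have hev : ∀ᶠ s in 𝓝 t, (X s).det ≠ 0 := hdet.continuousAt.eventually_ne h0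
  have h2 : HasMatDeriv (fun s => (X s)⁻¹ * X s) 0 t :=
    (HasMatDeriv.const (1 : Mat2)).congr_of_eventuallyEq
      (hev.mono fun s hs => Matrix.nonsing_inv_mul _ (Ne.isUnit hs))
  have h3 := h1.unique h2
  refine hZ'.congr_deriv ?_
  have h4 : X t * (X t)⁻¹ = 1 := Matrix.mul_nonsing_inv _ (Ne.isUnit h0)
  calc Matrix.of Z' = Matrix.of Z' * (X t * (X t)⁻¹) := by rw [h4, mul_one]
    _ = (Matrix.of Z' * X t + (X t)⁻¹ * X') * (X t)⁻¹ - (X t)⁻¹ * X' * (X t)⁻¹ := by noncomm_ring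
    _ = _ := by rw [h3]; simp

end HasMatDeriv

/-- Global solvability of the matrix hamiltonian system with continuous coefficients. -/
theorem exists_matrix_hamiltonian_solution {A B C : ℝ → Mat2}
    (hA : ∀ i j, Continuous fun t => A t i j) (hB : ∀ i j, Continuous fun t => B t i j)
    (hC : ∀ i j, Continuous fun t => C t i j) (T : ℝ) (X₀ U₀ : Mat2) :
    ∃ X U : ℝ → Mat2, X T = X₀ ∧ U T = U₀ ∧ (∀ t, HasMatDeriv X (A t * X t + B t * U t) t) ∧
      ∀ t, HasMatDeriv U (C t * X t - (A t)ᴴ * U t) t := by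
  have hM : ∀ i j, Continuous fun t => Matrix.fromBlocks (A t) (B t) (C t) (-(A t)ᴴ) i j := by
    rintro (i | i) (j | j)
    · exact hA i j
    · exact hB i j
    · exact hC i j
    · exact ((hA j i).star).neg
  choose y hy0 hy using fun j : Fin 2 => exists_linear_solution _ hM T
    (Sum.elim (fun i => X₀ i j) fun i => U₀ i j)
  refine ⟨fun t => Matrix.of fun i j => y j t (Sum.inl i),
    fun t => Matrix.of fun i j => y j t (Sum.inr i), ?_, ?_, fun t i j => ?_, fun t i j => ?_⟩
  · ext i j; simp [hy0]
  · ext i j; simp [hy0]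
  · refine (hy j t (Sum.inl i)).congr_deriv ?_
    simp [Matrix.mulVec, dotProduct, Matrix.mul_apply]
  · refine (hy j t (Sum.inr i)).congr_deriv ?_
    simp [Matrix.mulVec, dotProduct, Matrix.mul_apply, sub_eq_add_neg]

/-- A hamiltonian pair that is conjoined at one point is conjoined everywhere. -/
theorem conjoined_of_conjoined_at {A B C X U : ℝ → Mat2} (hB : ∀ t, (B t).IsHermitian)
    (hC : ∀ t, (C t).IsHermitian) (hX : ∀ t, HasMatDeriv X (A t * X t + B t * U t) t)
    (hU : ∀ t, HasMatDeriv U (C t * X t - (A t)ᴴ * U t) t) {T : ℝ}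
    (hT : (X T)ᴴ * U T = (U T)ᴴ * X T) (t : ℝ) : (X t)ᴴ * U t = (U t)ᴴ * X t := by
  have key : ∀ t, HasMatDeriv (fun t => (X t)ᴴ * U t - (U t)ᴴ * X t) 0 t := by
    intro t
    refine (((hX t).conjTranspose.mul (hU t)).sub ((hU t).conjTranspose.mul (hX t))).congr_deriv ?_
    simp only [Matrix.conjTranspose_add, Matrix.conjTranspose_sub, Matrix.conjTranspose_mul,
      Matrix.conjTranspose_conjTranspose, (hB t).eq, (hC t).eq]
    noncomm_ring
  have hc : ∀ i j, ((X t)ᴴ * U t - (U t)ᴴ * X t) i j = ((X T)ᴴ * U T - (U T)ᴴ * X T) i j :=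
    fun i j => is_const_of_deriv_eq_zero (fun s => (key s i j).differentiableAt)
      (fun s => (key s i j).deriv) t T
  have : (X t)ᴴ * U t - (U t)ᴴ * X t = 0 := by
    ext i j; rw [hc, hT, sub_self]
  exact sub_eq_zero.1 this

/-- `V = U X⁻¹` satisfies the matrix Riccati equation. -/
theorem hasMatDeriv_riccati {A B C X U : ℝ → Mat2} {t : ℝ}
    (hX : HasMatDeriv X (A t * X t + B t * U t) t)
    (hU : HasMatDeriv U (C t * X t - (A t)ᴴ * U t) t) (h0 : (X t).det ≠ 0) :
    HasMatDeriv (fun s => U s * (X s)⁻¹) (C t - (A t)ᴴ * (U t * (X t)⁻¹) -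
      U t * (X t)⁻¹ * A t - U t * (X t)⁻¹ * B t * (U t * (X t)⁻¹)) t := by
  refine (hU.mul (hX.inv h0)).congr_deriv ?_
  have h4 : X t * (X t)⁻¹ = 1 := Matrix.mul_nonsing_inv _ (Ne.isUnit h0)
  set Z := (X t)⁻¹
  calc (C t * X t - (A t)ᴴ * U t) * Z + U t * -(Z * (A t * X t + B t * U t) * Z)
      = C t * (X t * Z) - (A t)ᴴ * (U t * Z) - U t * Z * A t * (X t * Z)
        - U t * Z * B t * (U t * Z) := by noncomm_ring
    _ = _ := by rw [h4, mul_one, mul_one]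

theorem isHermitian_mul_inv_of_conjoined {X U : Mat2} (h : Xᴴ * U = Uᴴ * X) (h0 : X.det ≠ 0) :
    (U * X⁻¹).IsHermitian := by
  have h4 : X * X⁻¹ = 1 := Matrix.mul_nonsing_inv _ (Ne.isUnit h0)
  have h5 : X⁻¹ᴴ * Xᴴ = 1 := by rw [← Matrix.conjTranspose_mul, h4, Matrix.conjTranspose_one]
  rw [Matrix.IsHermitian, Matrix.conjTranspose_mul]
  calc X⁻¹ᴴ * Uᴴ = X⁻¹ᴴ * (Uᴴ * X) * X⁻¹ := by rw [mul_assoc, mul_assoc, h4, mul_one]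
    _ = (X⁻¹ᴴ * Xᴴ) * (U * X⁻¹) := by rw [← h]; noncomm_ring
    _ = U * X⁻¹ := by rw [h5, one_mul]

/-! ### The gauged system and its global Riccati solution. -/

/-- The data of a hamiltonian system `X' = 𝒫 X + 𝓑 U`, `U' = 𝒬 X - 𝒫* U` with off-diagonal `𝒫` and
positive diagonal `𝓑`. -/
structure GaugedSystem where
  d₁ : ℝ → ℝ
  d₂ : ℝ → ℝ
  α : ℝ → ℂ
  β : ℝ → ℂ
  κ : ℝ → ℂ
  q₁ : ℝ → ℝ
  q₂ : ℝ → ℝ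
  cont_d₁ : Continuous d₁
  cont_d₂ : Continuous d₂
  cont_α : Continuous α
  cont_β : Continuous β
  cont_κ : Continuous κ
  cont_q₁ : Continuous q₁
  cont_q₂ : Continuous q₂
  d₁_pos : ∀ t, 0 < d₁ t
  d₂_pos : ∀ t, 0 < d₂ t

namespace GaugedSystem

variable (c : GaugedSystem)

/-- The off-diagonal coefficient. -/
def cP (t : ℝ) : Mat2 := !![0, c.d₁ t * c.α t; c.d₂ t * conj (c.β t), 0]

/-- The positive diagonal coefficient. -/
def cB (t : ℝ) : Mat2 := !![(c.d₁ t : ℂ), 0; 0, c.d₂ t]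

/-- The Hermitian coefficient. -/
def cQ (t : ℝ) : Mat2 := !![(c.q₁ t : ℂ), c.κ t; conj (c.κ t), c.q₂ t]

theorem continuous_cP (i j : Fin 2) : Continuous fun t => c.cP t i j := by
  have := c.cont_d₁
  have := c.cont_d₂
  have := c.cont_α
  have := c.cont_β
  fin_cases i <;> fin_cases j <;> simp only [cP] <;> simp <;> fun_prop

theorem continuous_cB (i j : Fin 2) : Continuous fun t => c.cB t i j := by
  have := c.cont_d₁
  have := c.cont_d₂
  fin_cases i <;> fin_cases j <;> simp only [cB] <;> simp <;> fun_prop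

theorem continuous_cQ (i j : Fin 2) : Continuous fun t => c.cQ t i j := by
  have := c.cont_q₁
  have := c.cont_q₂
  have := c.cont_κ
  fin_cases i <;> fin_cases j <;> simp only [cQ] <;> simp <;> fun_prop

theorem isHermitian_cB (t : ℝ) : (c.cB t).IsHermitian := by
  ext i j; fin_cases i <;> fin_cases j <;> simp [cB]

theorem isHermitian_cQ (t : ℝ) : (c.cQ t).IsHermitian := by
  ext i j; fin_cases i <;> fin_cases j <;> simp [cQ]

/-- Right-hand side of the Riccati equation. -/
noncomputable def riccatiRHS (t : ℝ) (V : Mat2) : Mat2 :=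
  c.cQ t - (c.cP t)ᴴ * V - V * c.cP t - V * c.cB t * V

/-- Writing the entries of `𝒫` as `d₁ α` and `d₂ conj β` lets the diagonal equations be completed to
squares in `w + β` and `w + α`. The off-diagonal equation is damped at the rate `d₁ v₁ + d₂ v₂`. -/
theorem riccati_scalar {V : ℝ → Mat2} {t : ℝ} (hV : (V t).IsHermitian)
    (hd : HasMatDeriv V (c.riccatiRHS t (V t)) t) :
    HasDerivAt (fun s => (V s 0 0).re) (-c.d₁ t * (V t 0 0).re ^ 2
      - c.d₂ t * ‖V t 0 1 + c.β t‖ ^ 2 + c.d₂ t * ‖c.β t‖ ^ 2 + c.q₁ t) t ∧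
    HasDerivAt (fun s => (V s 1 1).re) (-c.d₂ t * (V t 1 1).re ^ 2
      - c.d₁ t * ‖V t 0 1 + c.α t‖ ^ 2 + c.d₁ t * ‖c.α t‖ ^ 2 + c.q₂ t) t ∧
    HasDerivAt (fun s => V s 0 1) (-((c.d₁ t * (V t 0 0).re + c.d₂ t * (V t 1 1).re : ℝ) : ℂ)
      * V t 0 1 - c.d₁ t * (V t 0 0).re * c.α t - c.d₂ t * (V t 1 1).re * c.β t + c.κ t) t := by
  have h00 : V t 0 0 = ((V t 0 0).re : ℂ) := (Complex.conj_eq_iff_re.1 (hV.apply 0 0)).symm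
  have h11 : V t 1 1 = ((V t 1 1).re : ℂ) := (Complex.conj_eq_iff_re.1 (hV.apply 1 1)).symm
  have h10 : V t 1 0 = conj (V t 0 1) := (hV.apply 1 0).symm
  have e00 := hd 0 0
  have e11 := hd 1 1
  have e01 := hd 0 1
  simp only [riccatiRHS, cP, cB, cQ, Matrix.sub_apply, Matrix.mul_apply, Fin.sum_univ_two,
    Matrix.conjTranspose_apply, Matrix.of_apply, Matrix.cons_val_zero, Matrix.cons_val_one,
    Matrix.cons_val', Matrix.cons_val_fin_one] at e00 e11 e01
  rw [h10] at e00 e11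
  generalize (V t 0 0).re = x at *
  generalize (V t 1 1).re = y at *
  refine ⟨?_, ?_, ?_⟩
  · refine (Complex.reCLM.hasFDerivAt.comp_hasDerivAt t e00).congr_deriv ?_
    rw [h00]
    generalize V t 0 1 = w
    simp [← Complex.normSq_eq_norm_sq, Complex.normSq_apply]
    ring
  · refine (Complex.reCLM.hasFDerivAt.comp_hasDerivAt t e11).congr_deriv ?_
    rw [h11]
    generalize V t 0 1 = w
    simp [← Complex.normSq_eq_norm_sq, Complex.normSq_apply]
    ring
  · refine e01.congr_deriv ?_
    rw [h00, h11]
    push_cast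
    simp
    ring

variable {c}

/-- While the diagonal entries are nonnegative, the off-diagonal entry of a Riccati solution
satisfies the damped linear estimate. -/
theorem norm_offDiag_le {v₁ v₂ : ℝ → ℝ} {w : ℝ → ℂ} {T b : ℝ}
    (hw : ∀ t ∈ Icc T b, HasDerivAt w (-((c.d₁ t * v₁ t + c.d₂ t * v₂ t : ℝ) : ℂ) * w t
      - c.d₁ t * v₁ t * c.α t - c.d₂ t * v₂ t * c.β t + c.κ t) t)
    (h1 : ∀ t ∈ Ico T b, 0 ≤ v₁ t) (h2 : ∀ t ∈ Ico T b, 0 ≤ v₂ t) (hTb : T ≤ b)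
    {γ : ℝ → ℂ} {R : ℝ}
    (hR : ∀ τ ∈ Icc T b,
      ‖c.α τ - c.β τ‖ + ‖γ b - γ τ + ∫ s in τ..b, c.κ s‖ ≤ R)
    (hγ : ∀ t, γ t = c.α t ∨ γ t = c.β t) (hT : w T = -c.β T) : ‖w b + γ b‖ ≤ R := by
  -- With `b` frozen, adding `∫ s in τ..b, κ` removes the forcing `κ`, and `Y` equals `w + γ` at `τ
  -- = b`.
  set Y : ℝ → ℂ := fun τ => w τ + γ b + ∫ s in τ..b, c.κ s with hY
  have hYd : ∀ t ∈ Icc T b, HasDerivAt Y (-((c.d₁ t * v₁ t + c.d₂ t * v₂ t : ℝ) : ℂ) * w t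
      - c.d₁ t * v₁ t * c.α t - c.d₂ t * v₂ t * c.β t) t := by
    intro t ht
    refine (((hw t ht).add_const (γ b)).add (intervalIntegral.integral_hasDerivAt_left
      (c.cont_κ.intervalIntegrable _ _) c.cont_κ.aestronglyMeasurable.stronglyMeasurableAtFilter
      c.cont_κ.continuousAt)).congr_deriv ?_
    ring
  have hYb : Y b = w b + γ b := by simp [hY]
  have hR0 : 0 ≤ R := le_trans (by positivity) (hR T ⟨le_rfl, hTb⟩)
  rw [← hYb]
  refine norm_le_of_damped (s := fun t => c.d₁ t * v₁ t + c.d₂ t * v₂ t)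
    (b := fun t => (c.d₁ t * v₁ t + c.d₂ t * v₂ t : ℝ) * (γ b + ∫ s in t..b, c.κ s)
      - c.d₁ t * v₁ t * c.α t - c.d₂ t * v₂ t * c.β t) hTb hR0
    (fun t ht => (hYd t ht).continuousAt.continuousWithinAt) ?_ ?_ ?_ ?_
  · intro t ht
    refine (hYd t (Ico_subset_Icc_self ht)).congr_deriv ?_
    simp only [hY]; ring
  · intro t ht
    exact add_nonneg (mul_nonneg (c.d₁_pos t).le (h1 t ht)) (mul_nonneg (c.d₂_pos t).le (h2 t ht))
  · intro t ht
    have hs1 := mul_nonneg (c.d₁_pos t).le (h1 t ht)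
    have hs2 := mul_nonneg (c.d₂_pos t).le (h2 t ht)
    have hRt := hR t (Ico_subset_Icc_self ht)
    set s₁ := c.d₁ t * v₁ t
    set s₂ := c.d₂ t * v₂ t
    set N := γ b - γ t + ∫ s in t..b, c.κ s
    have hn1 : ‖((s₁ : ℝ) : ℂ)‖ = s₁ := by rw [Complex.norm_real, Real.norm_of_nonneg hs1]
    have hn2 : ‖((s₂ : ℝ) : ℂ)‖ = s₂ := by rw [Complex.norm_real, Real.norm_of_nonneg hs2]
    have hn : ‖((s₁ + s₂ : ℝ) : ℂ)‖ = s₁ + s₂ := by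
      rw [Complex.norm_real, Real.norm_of_nonneg (add_nonneg hs1 hs2)]
    have e1 : γ b + ∫ s in t..b, c.κ s = N + γ t := by simp only [N]; ring
    have c1 : (c.d₁ t : ℂ) * v₁ t = (s₁ : ℂ) := by simp [s₁]
    have c2 : (c.d₂ t : ℂ) * v₂ t = (s₂ : ℂ) := by simp [s₂]
    rw [e1, c1, c2]
    -- The forcing is `(s₁ + s₂) N` plus `s₂ (α - β)` or `-s₁ (α - β)`, hence bounded by `(s₁ +
    -- s₂)(‖N‖ + ‖α - β‖) ≤ (s₁ + s₂) R`.
    rcases hγ t with h | h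
    · have e2 : ((s₁ + s₂ : ℝ) : ℂ) * (N + γ t) - s₁ * c.α t - s₂ * c.β t =
          ((s₁ + s₂ : ℝ) : ℂ) * N + s₂ * (c.α t - c.β t) := by rw [h]; push_cast; ring
      rw [e2]
      refine (norm_add_le _ _).trans ?_
      rw [norm_mul, norm_mul, hn, hn2]
      nlinarith [norm_nonneg (c.α t - c.β t), norm_nonneg N]
    · have e2 : ((s₁ + s₂ : ℝ) : ℂ) * (N + γ t) - s₁ * c.α t - s₂ * c.β t =
          ((s₁ + s₂ : ℝ) : ℂ) * N - s₁ * (c.α t - c.β t) := by rw [h]; push_cast; ring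
      rw [e2]
      refine (norm_sub_le _ _).trans ?_
      rw [norm_mul, norm_mul, hn, hn1]
      nlinarith [norm_nonneg (c.α t - c.β t), norm_nonneg N]
  · have hRT := hR T ⟨le_rfl, hTb⟩
    have e1 : Y T = (γ T - c.β T) + (γ b - γ T + ∫ s in T..b, c.κ s) := by
      simp only [hY, hT]; ring
    rw [e1]
    refine (norm_add_le _ _).trans (le_trans (add_le_add_left ?_ _) hRT)
    rcases hγ T with h | h <;> simp [h]

/-- The a priori estimate: the diagonal entries of the Riccati solution stay positive. -/
theorem diag_pos {v₁ v₂ : ℝ → ℝ} {w : ℝ → ℂ} {T b x₁ x₂ : ℝ} {R₃ R₄ h₃ h₄ : ℝ → ℝ}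
    (hv₁ : ∀ t ∈ Icc T b, HasDerivAt v₁ (-c.d₁ t * v₁ t ^ 2 - c.d₂ t * ‖w t + c.β t‖ ^ 2
      + c.d₂ t * ‖c.β t‖ ^ 2 + c.q₁ t) t)
    (hv₂ : ∀ t ∈ Icc T b, HasDerivAt v₂ (-c.d₂ t * v₂ t ^ 2 - c.d₁ t * ‖w t + c.α t‖ ^ 2
      + c.d₁ t * ‖c.α t‖ ^ 2 + c.q₂ t) t)
    (hw : ∀ t ∈ Icc T b, HasDerivAt w (-((c.d₁ t * v₁ t + c.d₂ t * v₂ t : ℝ) : ℂ) * w t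
      - c.d₁ t * v₁ t * c.α t - c.d₂ t * v₂ t * c.β t + c.κ t) t)
    (hR₃ : ∀ τ t, T ≤ τ → τ ≤ t →
      ‖c.α τ - c.β τ‖ + ‖c.β t - c.β τ + ∫ s in τ..t, c.κ s‖ ≤ R₃ t)
    (hR₄ : ∀ τ t, T ≤ τ → τ ≤ t →
      ‖c.α τ - c.β τ‖ + ‖c.α t - c.α τ + ∫ s in τ..t, c.κ s‖ ≤ R₄ t)
    (hh₃ : ∀ t, T ≤ t → h₃ t = c.d₂ t * R₃ t ^ 2 - c.d₂ t * ‖c.β t‖ ^ 2 - c.q₁ t)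
    (hh₄ : ∀ t, T ≤ t → h₄ t = c.d₁ t * R₄ t ^ 2 - c.d₁ t * ‖c.α t‖ ^ 2 - c.q₂ t)
    (hp₁ : ∀ (b : ℝ) (v v' : ℝ → ℝ), T ≤ b → ContinuousOn v (Icc T b) →
      (∀ t ∈ Ico T b, HasDerivAt v (v' t) t) → (∀ t ∈ Ico T b, -c.d₁ t * v t ^ 2 - h₃ t ≤ v' t) →
      x₁ < v T → 0 < v b)
    (hp₂ : ∀ (b : ℝ) (v v' : ℝ → ℝ), T ≤ b → ContinuousOn v (Icc T b) →
      (∀ t ∈ Ico T b, HasDerivAt v (v' t) t) → (∀ t ∈ Ico T b, -c.d₂ t * v t ^ 2 - h₄ t ≤ v' t) →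
      x₂ < v T → 0 < v b)
    (hT : w T = -c.β T) (hT₁ : x₁ < v₁ T) (hT₂ : x₂ < v₂ T) :
    ∀ t ∈ Icc T b, 0 < v₁ t ∧ 0 < v₂ t := by
  by_contra! hcon
  obtain ⟨t', ht', hbad⟩ := hcon
  have hc₁ : ContinuousOn v₁ (Icc T b) := fun t ht => (hv₁ t ht).continuousAt.continuousWithinAt
  have hc₂ : ContinuousOn v₂ (Icc T b) := fun t ht => (hv₂ t ht).continuousAt.continuousWithinAt
  set Z : Set ℝ := Icc T b ∩ {t | min (v₁ t) (v₂ t) ≤ 0} with hZ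
  have hZc : IsCompact Z := by
    refine isCompact_Icc.of_isClosed_subset ?_ inter_subset_left
    exact (hc₁.inf hc₂).preimage_isClosed_of_isClosed isClosed_Icc isClosed_Iic
  have hZne : Z.Nonempty := by
    refine ⟨t', ht', ?_⟩
    by_cases h : 0 < v₁ t'
    · exact (min_le_right _ _).trans (hbad h)
    · exact (min_le_left _ _).trans (not_lt.1 h)
  -- At the first failure time `t₁` the off-diagonal bounds still hold on `[T, t₁)`, so both entries
  -- are supersolutions up to `t₁`, and persistence makes them positive at `t₁` itself.
  set t₁ := sInf Z with ht₁
  have ht₁Z : t₁ ∈ Z := hZc.sInf_mem hZne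
  have hpos : ∀ t ∈ Ico T t₁, 0 < v₁ t ∧ 0 < v₂ t := by
    intro t ht
    have : t ∉ Z := fun h => absurd (csInf_le hZc.bddBelow h) (not_le.2 ht.2)
    have h2 : ¬ min (v₁ t) (v₂ t) ≤ 0 := fun h => this ⟨⟨ht.1, ht.2.le.trans ht₁Z.1.2⟩, h⟩
    exact lt_min_iff.1 (not_le.1 h2)
  have hsub : ∀ {t}, t ∈ Ico T t₁ → Icc T t ⊆ Icc T b := fun {t} ht =>
    Icc_subset_Icc_right (ht.2.le.trans ht₁Z.1.2)
  have hmem : ∀ t ∈ Ico T t₁, t ∈ Icc T b := fun t ht => hsub ht ⟨ht.1, le_rfl⟩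
  have hsub₁ : Icc T t₁ ⊆ Icc T b := Icc_subset_Icc_right ht₁Z.1.2
  have hwβ : ∀ t ∈ Ico T t₁, ‖w t + c.β t‖ ≤ R₃ t := fun t ht =>
    norm_offDiag_le (fun s hs => hw s (hsub ht hs))
      (fun s hs => (hpos s ⟨hs.1, hs.2.trans ht.2⟩).1.le)
      (fun s hs => (hpos s ⟨hs.1, hs.2.trans ht.2⟩).2.le) ht.1
      (fun τ hτ => hR₃ τ t hτ.1 hτ.2) (fun _ => Or.inr rfl) hT
  have hwα : ∀ t ∈ Ico T t₁, ‖w t + c.α t‖ ≤ R₄ t := fun t ht =>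
    norm_offDiag_le (fun s hs => hw s (hsub ht hs))
      (fun s hs => (hpos s ⟨hs.1, hs.2.trans ht.2⟩).1.le)
      (fun s hs => (hpos s ⟨hs.1, hs.2.trans ht.2⟩).2.le) ht.1
      (fun τ hτ => hR₄ τ t hτ.1 hτ.2) (fun _ => Or.inl rfl) hT
  have p₁ : 0 < v₁ t₁ := by
    refine hp₁ t₁ v₁ _ ht₁Z.1.1 (hc₁.mono hsub₁) (fun t ht => hv₁ t (hmem t ht)) ?_ hT₁
    intro t ht
    have h1 := pow_le_pow_left₀ (norm_nonneg _) (hwβ t ht) 2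
    have h2 := mul_le_mul_of_nonneg_left h1 (c.d₂_pos t).le
    rw [hh₃ t ht.1]
    linarith
  have p₂ : 0 < v₂ t₁ := by
    refine hp₂ t₁ v₂ _ ht₁Z.1.1 (hc₂.mono hsub₁) (fun t ht => hv₂ t (hmem t ht)) ?_ hT₂
    intro t ht
    have h1 := pow_le_pow_left₀ (norm_nonneg _) (hwα t ht) 2
    have h2 := mul_le_mul_of_nonneg_left h1 (c.d₁_pos t).le
    rw [hh₄ t ht.1]
    linarith
  have h3 : min (v₁ t₁) (v₂ t₁) ≤ 0 := ht₁Z.2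
  exact absurd (lt_min p₁ p₂) (not_lt.2 h3)

/-- Existence of a global Hermitian solution of the matrix Riccati equation. -/
theorem exists_global_riccati {T : ℝ} {R₃ R₄ h₃ h₄ : ℝ → ℝ}
    (hR₃ : ∀ τ t, T ≤ τ → τ ≤ t →
      ‖c.α τ - c.β τ‖ + ‖c.β t - c.β τ + ∫ s in τ..t, c.κ s‖ ≤ R₃ t)
    (hR₄ : ∀ τ t, T ≤ τ → τ ≤ t →
      ‖c.α τ - c.β τ‖ + ‖c.α t - c.α τ + ∫ s in τ..t, c.κ s‖ ≤ R₄ t)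
    (hh₃ : ∀ t, T ≤ t → h₃ t = c.d₂ t * R₃ t ^ 2 - c.d₂ t * ‖c.β t‖ ^ 2 - c.q₁ t)
    (hh₄ : ∀ t, T ≤ t → h₄ t = c.d₁ t * R₄ t ^ 2 - c.d₁ t * ‖c.α t‖ ^ 2 - c.q₂ t)
    (hp₁ : PositivityPersists T c.d₁ h₃) (hp₂ : PositivityPersists T c.d₂ h₄) :
    ∃ V : ℝ → Mat2, ∀ t, T ≤ t → (V t).IsHermitian ∧
      HasMatDeriv V (c.riccatiRHS t (V t)) t := by
  obtain ⟨x₁, hx₁⟩ := hp₁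
  obtain ⟨x₂, hx₂⟩ := hp₂
  -- The diagonal lies above both persistence thresholds. The choice `w = -β` at `T` makes the
  -- initial distance from `-γ(T)` at most `‖α - β‖`, whether `γ` is `α` or `β`.
  set V₀ : Mat2 := !![((x₁ + 1 : ℝ) : ℂ), -c.β T; -conj (c.β T), ((x₂ + 1 : ℝ) : ℂ)] with hV₀
  have hV₀H : V₀ᴴ = V₀ := by
    ext i j; fin_cases i <;> fin_cases j <;> simp [hV₀]
  obtain ⟨X, U, hXT, hUT, hX, hU⟩ := exists_matrix_hamiltonian_solution c.continuous_cP
    c.continuous_cB c.continuous_cQ T 1 V₀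
  have hconj := conjoined_of_conjoined_at c.isHermitian_cB c.isHermitian_cQ hX hU (T := T)
    (by rw [hXT, hUT, hV₀H]; simp)
  set V : ℝ → Mat2 := fun t => U t * (X t)⁻¹ with hV
  have hVH : ∀ t, (X t).det ≠ 0 → (V t).IsHermitian := fun t ht =>
    isHermitian_mul_inv_of_conjoined (hconj t) ht
  have hVd : ∀ t, (X t).det ≠ 0 → HasMatDeriv V (c.riccatiRHS t (V t)) t := fun t ht =>
    hasMatDeriv_riccati (hX t) (hU t) ht
  have hVT : V T = V₀ := by simp [hV, hXT, hUT]
  have hpos : ∀ b, (∀ t ∈ Icc T b, (X t).det ≠ 0) →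
      ∀ t ∈ Icc T b, 0 < (V t 0 0).re ∧ 0 < (V t 1 1).re := by
    intro b hb
    have hsc := fun t ht => c.riccati_scalar (hVH t (hb t ht)) (hVd t (hb t ht))
    refine diag_pos (fun t ht => (hsc t ht).1) (fun t ht => (hsc t ht).2.1)
      (fun t ht => (hsc t ht).2.2) hR₃ hR₄ hh₃ hh₄ hx₁ hx₂ ?_ ?_ ?_ <;> rw [hVT] <;> simp [hV₀]
  -- Liouville's formula for `X' = (𝒫 + 𝓑 V) X`; the trace of `𝒫` is zero.
  have hdet : ∀ t, (X t).det ≠ 0 → HasDerivAt (fun s => (X s).det)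
      (((c.d₁ t * (V t 0 0).re + c.d₂ t * (V t 1 1).re : ℝ) : ℂ) * (X t).det) t := by
    intro t ht
    have hU' : U t = V t * X t := by
      rw [hV, Matrix.mul_assoc, Matrix.nonsing_inv_mul _ (Ne.isUnit ht), Matrix.mul_one]
    have hH := hVH t ht
    have h00 : V t 0 0 = ((V t 0 0).re : ℂ) := (Complex.conj_eq_iff_re.1 (hH.apply 0 0)).symm
    have h11 : V t 1 1 = ((V t 1 1).re : ℂ) := (Complex.conj_eq_iff_re.1 (hH.apply 1 1)).symm
    refine (hX t).det.congr_deriv ?_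
    rw [hU', Matrix.det_fin_two]
    push_cast
    rw [← h00, ← h11]
    simp only [cP, cB, Matrix.add_apply, Matrix.mul_apply, Fin.sum_univ_two, Matrix.of_apply,
      Matrix.cons_val_zero, Matrix.cons_val_one, Matrix.cons_val', Matrix.cons_val_fin_one]
    ring
  have hne : ∀ t, T ≤ t → (X t).det ≠ 0 := by
    by_contra! hcon
    obtain ⟨t', hTt', ht'⟩ := hcon
    have hc : Continuous fun t => (X t).det :=
      continuous_iff_continuousAt.2 fun t => (hX t).det.continuousAt
    set Z : Set ℝ := Icc T t' ∩ {t | (X t).det = 0} with hZ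
    have hZc : IsCompact Z := isCompact_Icc.inter_right (isClosed_eq hc continuous_const)
    set b := sInf Z with hb
    have hbZ : b ∈ Z := hZc.sInf_mem ⟨t', ⟨hTt', le_rfl⟩, ht'⟩
    have hlt : ∀ t ∈ Ico T b, (X t).det ≠ 0 := fun t ht h0 =>
      absurd (csInf_le hZc.bddBelow ⟨⟨ht.1, ht.2.le.trans hbZ.1.2⟩, h0⟩) (not_le.2 ht.2)
    have hposb : ∀ t ∈ Ico T b, 0 < (V t 0 0).re ∧ 0 < (V t 1 1).re := fun t ht =>
      hpos t (fun s hs => hlt s ⟨hs.1, hs.2.trans_lt ht.2⟩) t ⟨ht.1, le_rfl⟩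
    -- Positive diagonal entries make `|det X|` nondecreasing from the value `1`, so it has no first
    -- zero.
    have hmono : MonotoneOn (fun t => ‖(X t).det‖ ^ 2) (Icc T b) := by
      refine monotoneOn_of_deriv_nonneg (convex_Icc _ _) (hc.norm.pow 2).continuousOn ?_ ?_
      · intro t ht
        rw [interior_Icc] at ht
        exact (hdet t (hlt t (Ioo_subset_Ico_self ht))).norm_sq.differentiableAt
          |>.differentiableWithinAt
      · intro t ht
        rw [interior_Icc] at ht
        have ht' := Ioo_subset_Ico_self ht
        rw [(hdet t (hlt t ht')).norm_sq.deriv, ← Complex.real_smul, real_inner_smul_right,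
          real_inner_self_eq_norm_sq]
        have h1 := mul_pos (c.d₁_pos t) (hposb t ht').1
        have h2 := mul_pos (c.d₂_pos t) (hposb t ht').2
        positivity
    have h1 := hmono (left_mem_Icc.2 hbZ.1.1) (right_mem_Icc.2 hbZ.1.1) hbZ.1.1
    have h2 : (X b).det = 0 := hbZ.2
    simp only [h2, hXT, Matrix.det_one] at h1
    norm_num at h1
  exact ⟨V, fun t ht => ⟨hVH t (hne t ht), hVd t (hne t ht)⟩⟩

end GaugedSystem

/-! ### Domination of Hermitian forms and Schur complements. -/

section QuadraticForms

/-- The real part of the quadratic form `x* M x`. -/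
noncomputable def quadForm (M : Mat2) (x : Fin 2 → ℂ) : ℝ := (star x ⬝ᵥ M *ᵥ x).re

/-- The squared Euclidean norm. -/
noncomputable def sqNorm (x : Fin 2 → ℂ) : ℝ := ‖x 0‖ ^ 2 + ‖x 1‖ ^ 2

theorem sqNorm_nonneg (x : Fin 2 → ℂ) : 0 ≤ sqNorm x := by unfold sqNorm; positivity

theorem sqNorm_pos {x : Fin 2 → ℂ} (hx : x ≠ 0) : 0 < sqNorm x := by
  refine (sqNorm_nonneg x).lt_of_ne fun h => hx ?_
  have h0 := sq_nonneg ‖x 0‖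
  have h1 := sq_nonneg ‖x 1‖
  unfold sqNorm at h
  ext i
  fin_cases i
  · simpa using (by linarith : ‖x 0‖ ^ 2 = 0)
  · simpa using (by linarith : ‖x 1‖ ^ 2 = 0)

theorem sqNorm_smul (b : ℂ) (x : Fin 2 → ℂ) : sqNorm (b • x) = ‖b‖ ^ 2 * sqNorm x := by
  simp only [sqNorm, Pi.smul_apply, smul_eq_mul, norm_mul]; ring

theorem quadForm_le (M : Mat2) (x : Fin 2 → ℂ) : quadForm M x ≤ entryNormSum M * sqNorm x := by
  have h : ∀ i j, (star (x i) * (M i j * x j)).re ≤ ‖M i j‖ * sqNorm x := by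
    intro i j
    refine (Complex.re_le_norm _).trans ?_
    rw [norm_mul, norm_mul, norm_star]
    have : ‖x i‖ * ‖x j‖ ≤ sqNorm x := by
      unfold sqNorm
      fin_cases i <;> fin_cases j <;> simp <;>
        nlinarith [sq_nonneg (‖x 0‖ - ‖x 1‖), sq_nonneg ‖x 0‖, sq_nonneg ‖x 1‖]
    nlinarith [norm_nonneg (M i j)]
  simp only [quadForm, entryNormSum, dotProduct, Matrix.mulVec, Fin.sum_univ_two, Pi.star_apply,
    mul_add, Complex.add_re]
  linarith [h 0 0, h 0 1, h 1 0, h 1 1]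

theorem exists_quadForm_lt_of_det_ne_zero {S : Mat2} (hS : S.det ≠ 0) (V : Mat2) :
    ∃ r : ℝ, ∀ x, S *ᵥ x ≠ 0 → quadForm V x < r * sqNorm (S *ᵥ x) := by
  refine ⟨entryNormSum (S⁻¹ᴴ * V * S⁻¹) + 1, fun x hx => ?_⟩
  have h1 : quadForm V x = quadForm (S⁻¹ᴴ * V * S⁻¹) (S *ᵥ x) := by
    have h2 : S⁻¹ *ᵥ (S *ᵥ x) = x := by
      rw [Matrix.mulVec_mulVec, Matrix.nonsing_inv_mul _ (Ne.isUnit hS), Matrix.one_mulVec]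
    unfold quadForm
    rw [← Matrix.mulVec_mulVec, h2, ← Matrix.mulVec_mulVec, Matrix.dotProduct_mulVec _ S⁻¹ᴴ,
      ← Matrix.star_mulVec, h2]
  rw [h1]
  linarith [quadForm_le (S⁻¹ᴴ * V * S⁻¹) (S *ᵥ x), sqNorm_pos hx]

/-- A Hermitian form whose kernel contains that of `S` is dominated by a multiple of `|S x|²`. -/
theorem exists_quadForm_lt_of_mulVec_eq_zero {S W : Mat2} (hW : W.IsHermitian) {k : Fin 2 → ℂ}
    (hk : k ≠ 0) (hWk : W *ᵥ k = 0) (hSk : S *ᵥ k = 0) :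
    ∃ r : ℝ, ∀ x, S *ᵥ x ≠ 0 → quadForm W x < r * sqNorm (S *ᵥ x) := by
  -- `e` spans the orthogonal complement of `k`. Both forms ignore the component along `k`, so they
  -- are compared on the line through `e` only.
  set e : Fin 2 → ℂ := ![-conj (k 1), conj (k 0)] with he
  have hn : (sqNorm k : ℂ) ≠ 0 := Complex.ofReal_ne_zero.2 (sqNorm_pos hk).ne'
  have hnk : (sqNorm k : ℂ) = k 0 * conj (k 0) + k 1 * conj (k 1) := by
    simp [sqNorm, Complex.mul_conj, Complex.normSq_eq_norm_sq]
  -- If `S e = 0` the quotient takes its default value `0`, harmlessly: then `S x = 0` for all `x`.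
  refine ⟨quadForm W e / sqNorm (S *ᵥ e) + 1, fun x hx => ?_⟩
  set a : ℂ := (conj (k 0) * x 0 + conj (k 1) * x 1) / sqNorm k with ha
  set b : ℂ := (-k 1 * x 0 + k 0 * x 1) / sqNorm k with hb
  have hxe : x = a • k + b • e := by
    ext i
    fin_cases i
    · simp [ha, hb, he]; field_simp; rw [hnk]; ring
    · simp [ha, hb, he]; field_simp; rw [hnk]; ring
  have hSx : S *ᵥ x = b • S *ᵥ e := by
    rw [hxe, Matrix.mulVec_add, Matrix.mulVec_smul, Matrix.mulVec_smul, hSk, smul_zero, zero_add]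
  have hWx : W *ᵥ x = b • W *ᵥ e := by
    rw [hxe, Matrix.mulVec_add, Matrix.mulVec_smul, Matrix.mulVec_smul, hWk, smul_zero, zero_add]
  have hkW : star k ⬝ᵥ W *ᵥ e = 0 := by
    rw [Matrix.dotProduct_mulVec, ← hW.eq, ← Matrix.star_mulVec, hWk]; simp
  have hq : quadForm W x = ‖b‖ ^ 2 * quadForm W e := by
    unfold quadForm
    rw [hWx]
    nth_rewrite 1 [hxe]
    rw [star_add, star_smul, star_smul, add_dotProduct, smul_dotProduct, dotProduct_smul, hkW,
      smul_zero, smul_zero, zero_add, smul_dotProduct, dotProduct_smul, smul_smul]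
    have : star b * b = ((‖b‖ ^ 2 : ℝ) : ℂ) := by
      rw [mul_comm, Complex.star_def, Complex.mul_conj, Complex.normSq_eq_norm_sq]
    rw [this, smul_eq_mul, Complex.re_ofReal_mul]
  have hb0 : b ≠ 0 := by rintro h; exact hx (by rw [hSx, h, zero_smul])
  have hSe : S *ᵥ e ≠ 0 := by intro h; exact hx (by rw [hSx, h, smul_zero])
  have h1 := sqNorm_pos hSe
  have h2 : 0 < ‖b‖ ^ 2 := by positivity
  rw [hq, hSx, sqNorm_smul]
  have h3 : (quadForm W e / sqNorm (S *ᵥ e) + 1) * (‖b‖ ^ 2 * sqNorm (S *ᵥ e)) =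
      ‖b‖ ^ 2 * quadForm W e + ‖b‖ ^ 2 * sqNorm (S *ᵥ e) := by field_simp
  rw [h3]
  nlinarith [mul_pos h2 h1]

theorem star_dotProduct_mulVec {V : Mat2} (hV : V.IsHermitian) (x y : Fin 2 → ℂ) :
    star x ⬝ᵥ V *ᵥ y = conj (star y ⬝ᵥ V *ᵥ x) := by
  rw [Matrix.star_dotProduct, Matrix.star_mulVec, hV.eq, ← Matrix.dotProduct_mulVec,
    Complex.star_def]

theorem ofReal_quadForm {V : Mat2} (hV : V.IsHermitian) (k : Fin 2 → ℂ) :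
    (quadForm V k : ℂ) = star k ⬝ᵥ V *ᵥ k :=
  Complex.conj_eq_iff_re.1 (star_dotProduct_mulVec hV k k).symm

theorem quadForm_add_smul {V : Mat2} (hV : V.IsHermitian) (x k : Fin 2 → ℂ) (a : ℂ) :
    quadForm V (x + a • k) =
      quadForm V x + 2 * (conj a * (star k ⬝ᵥ V *ᵥ x)).re + ‖a‖ ^ 2 * quadForm V k := by
  have h1 : star (x + a • k) ⬝ᵥ V *ᵥ (x + a • k) = star x ⬝ᵥ V *ᵥ x
      + conj (conj a * (star k ⬝ᵥ V *ᵥ x)) + conj a * (star k ⬝ᵥ V *ᵥ x)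
      + (‖a‖ ^ 2 : ℝ) * (star k ⬝ᵥ V *ᵥ k) := by
    have : ((‖a‖ ^ 2 : ℝ) : ℂ) = a * conj a := by
      rw [Complex.mul_conj, Complex.normSq_eq_norm_sq]
    rw [this, map_mul, ← star_dotProduct_mulVec hV x k, Complex.conj_conj]
    simp only [star_add, star_smul, Matrix.mulVec_add, Matrix.mulVec_smul, add_dotProduct,
      dotProduct_add, smul_dotProduct, dotProduct_smul, smul_eq_mul, Complex.star_def]
    ring
  unfold quadForm
  rw [h1, ← ofReal_quadForm hV k]
  simp only [Complex.add_re, Complex.conj_re, ← Complex.ofReal_mul, Complex.ofReal_re]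
  ring

/-- The Schur complement of `V` with respect to `k`. -/
noncomputable def schurComplement (V : Mat2) (k : Fin 2 → ℂ) : Mat2 :=
  Matrix.of fun i j => V i j - (V *ᵥ k) i * conj ((V *ᵥ k) j) / quadForm V k

theorem isHermitian_schurComplement {V : Mat2} (hV : V.IsHermitian) (k : Fin 2 → ℂ) :
    (schurComplement V k).IsHermitian := by
  refine Matrix.IsHermitian.ext fun i j => ?_
  have h := hV.apply i j
  simp only [schurComplement, Matrix.of_apply, star_sub, h, Complex.star_def, map_div₀, map_mul,
    Complex.conj_conj, Complex.conj_ofReal, mul_comm]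

theorem schurComplement_mulVec {V : Mat2} (k x : Fin 2 → ℂ) :
    schurComplement V k *ᵥ x =
      V *ᵥ x - ((star (V *ᵥ k) ⬝ᵥ x) / quadForm V k) • V *ᵥ k := by
  ext i
  simp only [schurComplement, Matrix.mulVec, dotProduct, Fin.sum_univ_two, Matrix.of_apply,
    Pi.sub_apply, Pi.smul_apply, Pi.star_apply, smul_eq_mul, Complex.star_def]
  ring

theorem schurComplement_mulVec_self {V : Mat2} (hV : V.IsHermitian) {k : Fin 2 → ℂ}
    (hk : quadForm V k ≠ 0) : schurComplement V k *ᵥ k = 0 := by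
  rw [schurComplement_mulVec, Matrix.star_mulVec, hV.eq, ← Matrix.dotProduct_mulVec,
    ← ofReal_quadForm hV, div_self (Complex.ofReal_ne_zero.2 hk), one_smul, sub_self]

theorem quadForm_schurComplement {V : Mat2} (hV : V.IsHermitian) (k x : Fin 2 → ℂ) :
    quadForm (schurComplement V k) x =
      quadForm V x - ‖star k ⬝ᵥ V *ᵥ x‖ ^ 2 / quadForm V k := by
  have h1 : star x ⬝ᵥ schurComplement V k *ᵥ x = star x ⬝ᵥ V *ᵥ x
      - ((‖star k ⬝ᵥ V *ᵥ x‖ ^ 2 / quadForm V k : ℝ) : ℂ) := by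
    rw [schurComplement_mulVec, dotProduct_sub, dotProduct_smul, Matrix.star_mulVec, hV.eq,
      ← Matrix.dotProduct_mulVec, star_dotProduct_mulVec hV x k, Complex.ofReal_div,
      ← Complex.normSq_eq_norm_sq, Complex.normSq_eq_conj_mul_self, smul_eq_mul]
    ring
  rw [quadForm, h1, Complex.sub_re, Complex.ofReal_re]
  rfl

/-- The multiplier is the critical point of `a ↦ quadForm V (x + a • k)`, a minimum when the form is
positive on `k`. The critical value is a form in `x` that annihilates `k`. -/
theorem quadForm_add_smul_eq_schurComplement {V : Mat2} (hV : V.IsHermitian) {k : Fin 2 → ℂ}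
    (hk : quadForm V k ≠ 0) (x : Fin 2 → ℂ) :
    quadForm V (x + (-(star k ⬝ᵥ V *ᵥ x) / quadForm V k) • k) =
      quadForm (schurComplement V k) x := by
  rw [quadForm_add_smul hV, quadForm_schurComplement hV]
  set g := star k ⬝ᵥ V *ᵥ x
  set r := quadForm V k
  have h1 : conj (-g / (r : ℂ)) * g = ((-(‖g‖ ^ 2) / r : ℝ) : ℂ) := by
    rw [map_div₀, map_neg, Complex.conj_ofReal, ← Complex.normSq_eq_norm_sq]
    push_cast
    rw [Complex.normSq_eq_conj_mul_self]
    ring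
  rw [h1, Complex.ofReal_re, norm_div, norm_neg, Complex.norm_real, div_pow, Real.norm_eq_abs,
    sq_abs]
  field_simp
  ring

end QuadraticForms

/-! ### Lifting to the gauged system, Picone's identity, return to the original system. -/

/-- Uniqueness for a homogeneous linear system of two `2 × 2` matrix functions. -/
theorem matrix_pair_eq_zero {M₁₁ M₁₂ M₂₁ M₂₂ D G : ℝ → Mat2}
    (h₁₁ : ∀ i j, Continuous fun t => M₁₁ t i j) (h₁₂ : ∀ i j, Continuous fun t => M₁₂ t i j)
    (h₂₁ : ∀ i j, Continuous fun t => M₂₁ t i j) (h₂₂ : ∀ i j, Continuous fun t => M₂₂ t i j)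
    {a b s : ℝ} (hD : ∀ t ∈ Icc a b, HasMatDeriv D (M₁₁ t * D t + M₁₂ t * G t) t)
    (hG : ∀ t ∈ Icc a b, HasMatDeriv G (M₂₁ t * D t + M₂₂ t * G t) t)
    (hs : s ∈ Icc a b) (hDs : D s = 0) (hGs : G s = 0) :
    ∀ t ∈ Icc a b, D t = 0 ∧ G t = 0 := by
  have hM : ∀ i j, Continuous fun t => Matrix.fromBlocks (M₁₁ t) (M₁₂ t) (M₂₁ t) (M₂₂ t) i j := by
    rintro (i | i) (j | j)
    · exact h₁₁ i j
    · exact h₁₂ i j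
    · exact h₂₁ i j
    · exact h₂₂ i j
  have key : ∀ j, ∀ t ∈ Icc a b, (Sum.elim (fun i => D t i j) fun i => G t i j) = 0 := by
    intro j
    refine linear_solution_eq_zero hM (x := fun t => Sum.elim (fun i => D t i j) fun i => G t i j)
      ?_ hs (by funext i; rcases i with i | i <;> simp [hDs, hGs])
    rintro t ht (i | i)
    · refine (hD t ht i j).congr_deriv ?_
      simp [Matrix.mulVec, dotProduct, Matrix.mul_apply]
    · refine (hG t ht i j).congr_deriv ?_
      simp [Matrix.mulVec, dotProduct, Matrix.mul_apply]
  intro t ht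
  refine ⟨?_, ?_⟩ <;> ext i j
  · exact congrFun (key j t ht) (Sum.inl i)
  · exact congrFun (key j t ht) (Sum.inr i)

/-- A hamiltonian system with coefficients `A`, `B`, `C` whose factor `S` with `B = S 𝓑 S*`
intertwines it, on `[T, ∞)`, with a gauged system. -/
structure IsGauged (c : GaugedSystem) (A B C S : ℝ → Mat2) (T : ℝ) : Prop where
  cont_A : ∀ i j, Continuous fun t => A t i j
  cont_B : ∀ i j, Continuous fun t => B t i j
  cont_C : ∀ i j, Continuous fun t => C t i j
  cont_S : ∀ i j, Continuous fun t => S t i j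
  herm_B : ∀ t, (B t).IsHermitian
  herm_C : ∀ t, (C t).IsHermitian
  deriv_S : ∀ t, T ≤ t → HasMatDeriv S (A t * S t - S t * c.cP t) t
  eq_B : ∀ t, T ≤ t → B t = S t * c.cB t * (S t)ᴴ
  eq_Q : ∀ t, T ≤ t → c.cQ t = (S t)ᴴ * C t * S t

namespace IsGauged

variable {c : GaugedSystem} {A B C S : ℝ → Mat2} {T : ℝ}

/-- A solution of the original system with `φ(s) = 0` lifts to a solution of the gauged system with
`X(s) = 0`. -/
theorem exists_lift (h : IsGauged c A B C S T) {φ ψ : ℝ → Mat2}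
    (hφ : ∀ t, HasMatDeriv φ (A t * φ t + B t * ψ t) t)
    (hψ : ∀ t, HasMatDeriv ψ (C t * φ t - (A t)ᴴ * ψ t) t) {s : ℝ} (hs : T ≤ s) (hφs : φ s = 0) :
    ∃ X U : ℝ → Mat2, X s = 0 ∧ (∀ t, HasMatDeriv X (c.cP t * X t + c.cB t * U t) t) ∧
      (∀ t, HasMatDeriv U (c.cQ t * X t - (c.cP t)ᴴ * U t) t) ∧
      ∀ t ∈ Icc T s, φ t = S t * X t ∧ U t = (S t)ᴴ * ψ t := by
  obtain ⟨X, U, hXs, hUs, hX, hU⟩ := exists_matrix_hamiltonian_solution c.continuous_cP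
    c.continuous_cB c.continuous_cQ s 0 ((S s)ᴴ * ψ s)
  refine ⟨X, U, hXs, hX, hU, fun t ht => ?_⟩
  -- `S` may be singular, so `X` cannot be obtained as `S⁻¹ φ`. It is solved for backwards from `s`,
  -- and the errors `S X - φ` and `U - S* ψ` satisfy a homogeneous linear system with zero data at
  -- `s`.
  have key := matrix_pair_eq_zero (M₁₁ := A) (M₁₂ := fun t => S t * c.cB t)
    (M₂₁ := fun t => (S t)ᴴ * C t) (M₂₂ := fun t => -(c.cP t)ᴴ)
    (D := fun t => S t * X t - φ t) (G := fun t => U t - (S t)ᴴ * ψ t) h.cont_A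
    (fun i j => by
      simp only [Matrix.mul_apply]
      exact continuous_finsetSum _ fun k _ => (h.cont_S i k).mul (c.continuous_cB k j))
    (fun i j => by
      simp only [Matrix.mul_apply, Matrix.conjTranspose_apply]
      exact continuous_finsetSum _ fun k _ => (h.cont_S k i).star.mul (h.cont_C k j))
    (fun i j => (c.continuous_cP j i).star.neg) (a := T) (b := s) (s := s)
    (fun t ht => by
      refine (((h.deriv_S t ht.1).mul (hX t)).sub (hφ t)).congr_deriv ?_
      rw [h.eq_B t ht.1]
      noncomm_ring)
    (fun t ht => by
      refine ((hU t).sub ((h.deriv_S t ht.1).conjTranspose.mul (hψ t))).congr_deriv ?_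
      rw [h.eq_Q t ht.1]
      simp only [Matrix.conjTranspose_sub, Matrix.conjTranspose_mul]
      noncomm_ring)
    ⟨hs, le_rfl⟩ (by simp [hXs, hφs]) (by simp [hUs]) t ht
  exact ⟨(sub_eq_zero.1 key.1).symm, sub_eq_zero.1 key.2⟩

end IsGauged

namespace GaugedSystem

variable {c : GaugedSystem}

/-- The Picone identity. -/
theorem hasMatDeriv_picone {V X U : ℝ → Mat2} {t : ℝ} (hVH : (V t).IsHermitian)
    (hV : HasMatDeriv V (c.riccatiRHS t (V t)) t)
    (hX : HasMatDeriv X (c.cP t * X t + c.cB t * U t) t)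
    (hU : HasMatDeriv U (c.cQ t * X t - (c.cP t)ᴴ * U t) t) :
    HasMatDeriv (fun t => (X t)ᴴ * (U t - V t * X t))
      ((U t - V t * X t)ᴴ * c.cB t * (U t - V t * X t)) t := by
  refine (hX.conjTranspose.mul (hU.sub (hV.mul hX))).congr_deriv ?_
  simp only [riccatiRHS, Matrix.conjTranspose_add, Matrix.conjTranspose_sub,
    Matrix.conjTranspose_mul, hVH.eq, (c.isHermitian_cB t).eq]
  noncomm_ring

theorem re_conjTranspose_cB_mul (t : ℝ) (Y : Mat2) :
    ((Yᴴ * c.cB t * Y) 0 0).re = c.d₁ t * ‖Y 0 0‖ ^ 2 + c.d₂ t * ‖Y 1 0‖ ^ 2 := by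
  simp [cB, Matrix.mul_apply, Fin.sum_univ_two, ← Complex.normSq_eq_norm_sq, Complex.normSq_apply]
  ring

theorem picone_hasDerivAt {V X U : ℝ → Mat2} {t : ℝ} (hVH : (V t).IsHermitian)
    (hV : HasMatDeriv V (c.riccatiRHS t (V t)) t)
    (hX : HasMatDeriv X (c.cP t * X t + c.cB t * U t) t)
    (hU : HasMatDeriv U (c.cQ t * X t - (c.cP t)ᴴ * U t) t) :
    HasDerivAt (fun t => (((X t)ᴴ * (U t - V t * X t)) 0 0).re)
      (c.d₁ t * ‖(U t - V t * X t) 0 0‖ ^ 2 + c.d₂ t * ‖(U t - V t * X t) 1 0‖ ^ 2) t := by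
  rw [← re_conjTranspose_cB_mul]
  exact Complex.reCLM.hasFDerivAt.comp_hasDerivAt t (hasMatDeriv_picone hVH hV hX hU 0 0)

theorem picone_mono {V X U : ℝ → Mat2} {T : ℝ}
    (hV : ∀ t, T ≤ t → (V t).IsHermitian ∧ HasMatDeriv V (c.riccatiRHS t (V t)) t)
    (hX : ∀ t, T ≤ t → HasMatDeriv X (c.cP t * X t + c.cB t * U t) t)
    (hU : ∀ t, T ≤ t → HasMatDeriv U (c.cQ t * X t - (c.cP t)ᴴ * U t) t) :
    MonotoneOn (fun t => (((X t)ᴴ * (U t - V t * X t)) 0 0).re) (Ici T) := by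
  have hd := fun t ht => picone_hasDerivAt (hV t ht).1 (hV t ht).2 (hX t ht) (hU t ht)
  refine monotoneOn_of_deriv_nonneg (convex_Ici T)
    (fun t ht => (hd t ht).continuousAt.continuousWithinAt)
    (fun t ht => (hd t (interior_subset ht)).differentiableAt.differentiableWithinAt) ?_
  intro t ht
  rw [(hd t (interior_subset ht)).deriv]
  have h1 := c.d₁_pos t
  have h2 := c.d₂_pos t
  positivity

end GaugedSystem

theorem re_conjTranspose_mul_mul_apply (V X : Mat2) :
    ((Xᴴ * V * X) 0 0).re = quadForm V fun i => X i 0 := by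
  simp only [quadForm, Matrix.mul_apply, Fin.sum_univ_two, dotProduct, Matrix.mulVec,
    Matrix.conjTranspose_apply, Pi.star_apply]
  congr 1
  ring

theorem re_conjTranspose_mul_apply (X : Mat2) :
    ((Xᴴ * X) 0 0).re = sqNorm fun i => X i 0 := by
  simp [sqNorm, Matrix.mul_apply, Fin.sum_univ_two, ← Complex.normSq_eq_norm_sq,
    Complex.normSq_apply]

/-- The matrix all of whose columns are `v`. -/
def colMat (v : Fin 2 → ℂ) : Mat2 := Matrix.of fun i _ => v i

theorem mul_colMat (M : Mat2) (v : Fin 2 → ℂ) : M * colMat v = colMat (M *ᵥ v) := by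
  ext i j; simp [colMat, Matrix.mul_apply, Matrix.mulVec, dotProduct]

theorem colMat_zero : colMat 0 = 0 := by ext i j; simp [colMat]

/-- The system has a conjoined solution that is nondegenerate from some point on. -/
def HasNonsingularConjoined (A B C : ℝ → Mat2) : Prop :=
  ∃ (Φ Ψ : ℝ → Mat2) (T : ℝ), (∀ t, HasMatDeriv Φ (A t * Φ t + B t * Ψ t) t) ∧
    (∀ t, HasMatDeriv Ψ (C t * Φ t - (A t)ᴴ * Ψ t) t) ∧
    (∀ t, (Φ t)ᴴ * Ψ t = (Ψ t)ᴴ * Φ t) ∧ ∀ t, T ≤ t → (Φ t).det ≠ 0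

namespace IsGauged

variable {c : GaugedSystem} {A B C S : ℝ → Mat2} {T : ℝ}

/-- A criterion for a conjoined solution to be nondegenerate to the right of `T`. -/
theorem exists_nonsingular_of_quadForm_lt (h : IsGauged c A B C S T) {V : ℝ → Mat2}
    (hV : ∀ t, T ≤ t → (V t).IsHermitian ∧ HasMatDeriv V (c.riccatiRHS t (V t)) t)
    {k : ℝ → Fin 2 → ℂ} (hk : ∀ t, T ≤ t → HasMatDeriv (fun t => colMat (k t))
      (c.cP t * colMat (k t)) t) (hSk : ∀ t, T ≤ t → S t *ᵥ k t = 0)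
    (hκ : ∀ t, T ≤ t → 0 ≤ quadForm (V t) (k t)) {r : ℝ}
    (hr : ∀ x, S T *ᵥ x ≠ 0 → ∃ a : ℂ, quadForm (V T) (x + a • k T) < r * sqNorm (S T *ᵥ x)) :
    HasNonsingularConjoined A B C := by
  -- `Ψ(T) = r Φ(T)` with `r` real makes the pair conjoined and contributes `r |v|²` to the Picone
  -- form at `T`.
  obtain ⟨Φ, Ψ, hΦT, hΨT, hΦ, hΨ⟩ := exists_matrix_hamiltonian_solution h.cont_A h.cont_B h.cont_C
    T 1 ((r : ℂ) • (1 : Mat2))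
  refine ⟨Φ, Ψ, T, hΦ, hΨ, conjoined_of_conjoined_at h.herm_B h.herm_C hΦ hΨ (T := T) ?_, ?_⟩
  · rw [hΦT, hΨT]; simp
  intro s hs hdet
  obtain ⟨v, hv0, hv⟩ := Matrix.exists_mulVec_eq_zero_iff.2 hdet
  have hmulc : ∀ {Y : ℝ → Mat2} {Y' : Mat2} {t : ℝ} (N : Mat2), HasMatDeriv Y Y' t →
      HasMatDeriv (fun t => Y t * N) (Y' * N) t := fun N hY =>
    (hY.mul (HasMatDeriv.const N)).congr_deriv (by simp)
  obtain ⟨X, U, hXs, hX, hU, hlift⟩ := h.exists_lift (φ := fun t => Φ t * colMat v)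
    (ψ := fun t => Ψ t * colMat v)
    (fun t => (hmulc _ (hΦ t)).congr_deriv (by noncomm_ring))
    (fun t => (hmulc _ (hΨ t)).congr_deriv (by noncomm_ring)) hs
    (by simp only [mul_colMat, hv, colMat_zero])
  obtain ⟨hlT, hlT'⟩ := hlift T ⟨le_rfl, hs⟩
  obtain ⟨_, hls'⟩ := hlift s ⟨hs, le_rfl⟩
  set x : Fin 2 → ℂ := fun i => X T i 0 with hx
  have hSx : S T *ᵥ x = v := by
    ext i
    have := congrFun (congrFun hlT i) 0
    rw [hΦT, Matrix.one_mul] at this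
    simp only [colMat, Matrix.of_apply, Matrix.mul_apply] at this
    rw [this]; rfl
  obtain ⟨a, ha⟩ := hr x (by rwa [hSx])
  -- Adding a multiple of `k` to `X` alone gives another solution with the same `S X` and `U`, since
  -- `k' = 𝒫 k` and `𝒬 k = S* C S k = 0`. This is the freedom used to lower the form at `T`.
  set X' : ℝ → Mat2 := fun t => X t + a • colMat (k t) with hX'
  have hQk : ∀ t, T ≤ t → c.cQ t * colMat (k t) = 0 := fun t ht => by
    rw [h.eq_Q t ht, Matrix.mul_assoc, mul_colMat, hSk t ht, colMat_zero, Matrix.mul_zero]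
  have hX'd : ∀ t, T ≤ t → HasMatDeriv X' (c.cP t * X' t + c.cB t * U t) t := by
    intro t ht
    have h1 : HasMatDeriv X' (c.cP t * X t + c.cB t * U t + a • (c.cP t * colMat (k t))) t :=
      fun i j => (hX t i j).add ((hk t ht i j).const_mul a)
    refine h1.congr_deriv ?_
    simp only [hX', Matrix.mul_add, Matrix.mul_smul]
    abel
  have hUd : ∀ t, T ≤ t → HasMatDeriv U (c.cQ t * X' t - (c.cP t)ᴴ * U t) t := by
    intro t ht
    refine (hU t).congr_deriv ?_
    simp only [hX', Matrix.mul_add, Matrix.mul_smul, hQk t ht, smul_zero, add_zero]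
  have hmono := GaugedSystem.picone_mono hV hX'd hUd (mem_Ici.2 le_rfl) (mem_Ici.2 hs) hs
  have hcolX' : (fun i => X' T i 0) = x + a • k T := by
    ext i; simp [hX', hx, colMat]
  have hFT : (((X' T)ᴴ * (U T - V T * X' T)) 0 0).re =
      r * sqNorm v - quadForm (V T) (x + a • k T) := by
    have e1 : (X' T)ᴴ * (U T - V T * X' T) =
        (r : ℂ) • ((colMat v)ᴴ * colMat v) - (X' T)ᴴ * V T * X' T := by
      have e2 : S T * X' T = colMat v := by
        simp only [hX', Matrix.mul_add, Matrix.mul_smul, mul_colMat, hSk T le_rfl, colMat_zero,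
          smul_zero, add_zero]
        rw [← hlT, hΦT, Matrix.one_mul]
      have e3 : (X' T)ᴴ * (S T)ᴴ = (colMat v)ᴴ := by rw [← Matrix.conjTranspose_mul, e2]
      rw [Matrix.mul_sub, hlT', hΨT, ← Matrix.mul_assoc, e3, ← Matrix.mul_assoc]
      simp [Matrix.mul_assoc]
    rw [e1, Matrix.sub_apply, Complex.sub_re, re_conjTranspose_mul_mul_apply, hcolX',
      Matrix.smul_apply, smul_eq_mul, Complex.re_ofReal_mul, re_conjTranspose_mul_apply]
    rfl
  have hFs : (((X' s)ᴴ * (U s - V s * X' s)) 0 0).re = -(‖a‖ ^ 2 * quadForm (V s) (k s)) := by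
    have e0 : X' s = a • colMat (k s) := by simp [hX', hXs]
    have e2 : (colMat (k s))ᴴ * (S s)ᴴ = 0 := by
      rw [← Matrix.conjTranspose_mul, mul_colMat, hSk s hs, colMat_zero,
        Matrix.conjTranspose_zero]
    have e1 : (X' s)ᴴ * (U s - V s * X' s) =
        -(((‖a‖ ^ 2 : ℝ) : ℂ) • ((colMat (k s))ᴴ * V s * colMat (k s))) := by
      have e3 : ((‖a‖ ^ 2 : ℝ) : ℂ) = a * star a := by
        rw [Complex.star_def, Complex.mul_conj, Complex.normSq_eq_norm_sq]
      rw [e0, Matrix.mul_sub, hls', Matrix.conjTranspose_smul, ← Matrix.mul_assoc,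
        Matrix.smul_mul, e2, smul_zero, Matrix.zero_mul, zero_sub, e3]
      simp only [Matrix.smul_mul, Matrix.mul_smul, smul_smul, Matrix.mul_assoc]
    rw [e1, Matrix.neg_apply, Complex.neg_re, Matrix.smul_apply, smul_eq_mul,
      Complex.re_ofReal_mul, re_conjTranspose_mul_mul_apply]
    rfl
  -- The monotone Picone form is positive at `T` and equals `-‖a‖² k* V k ≤ 0` at `s`, a
  -- contradiction.
  simp only at hmono
  rw [hFT, hFs, ← hSx] at hmono
  have := mul_nonneg (sq_nonneg ‖a‖) (hκ s hs)
  linarith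

theorem mono (h : IsGauged c A B C S T) {T' : ℝ} (hT : T ≤ T') : IsGauged c A B C S T' :=
  { h with
    deriv_S := fun t ht => h.deriv_S t (hT.trans ht)
    eq_B := fun t ht => h.eq_B t (hT.trans ht)
    eq_Q := fun t ht => h.eq_Q t (hT.trans ht) }

theorem hasNonsingularConjoined_of_quadForm_lt (h : IsGauged c A B C S T) {V : ℝ → Mat2}
    (hV : ∀ t, T ≤ t → (V t).IsHermitian ∧ HasMatDeriv V (c.riccatiRHS t (V t)) t)
    (hr : ∃ r : ℝ, ∀ x, S T *ᵥ x ≠ 0 → quadForm (V T) x < r * sqNorm (S T *ᵥ x)) :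
    HasNonsingularConjoined A B C := by
  obtain ⟨r, hr⟩ := hr
  refine h.exists_nonsingular_of_quadForm_lt hV (k := fun _ => 0) (r := r)
    (fun t _ => (HasMatDeriv.const (colMat 0)).congr_deriv ?_)
    (fun t _ => Matrix.mulVec_zero _) (fun t _ => ?_) (fun x hx => ⟨0, ?_⟩)
  · rw [colMat_zero, Matrix.mul_zero]
  · simp [quadForm]
  · rw [smul_zero, add_zero]; exact hr x hx

/-- If `S(T)` is singular, its kernel extends to a solution `k` of `k' = 𝒫 k` with `S k = 0`. -/
theorem exists_kernel_solution (h : IsGauged c A B C S T) (hdet : (S T).det = 0) :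
    ∃ k : ℝ → Fin 2 → ℂ, (∀ t, HasMatDeriv (fun t => colMat (k t)) (c.cP t * colMat (k t)) t) ∧
      ∀ t, T ≤ t → k t ≠ 0 ∧ S t *ᵥ k t = 0 := by
  obtain ⟨k₀, hk₀, hSk₀⟩ := Matrix.exists_mulVec_eq_zero_iff.2 hdet
  obtain ⟨k, hkT, hk⟩ := exists_linear_solution c.cP c.continuous_cP T k₀
  have hkd : ∀ t, HasMatDeriv (fun t => colMat (k t)) (c.cP t * colMat (k t)) t := by
    intro t i j
    rw [mul_colMat]
    exact hk t i
  refine ⟨k, hkd, fun t ht => ⟨fun h0 => hk₀ ?_, ?_⟩⟩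
  · rw [← hkT]
    exact linear_solution_eq_zero c.continuous_cP (a := T) (b := t) (fun s _ => hk s)
      ⟨ht, le_rfl⟩ h0 T ⟨le_rfl, ht⟩
  · have h1 := (matrix_pair_eq_zero (M₁₁ := A) (M₁₂ := fun _ => 0) (M₂₁ := fun _ => 0)
      (M₂₂ := fun _ => 0) (D := fun t => S t * colMat (k t)) (G := fun _ => 0) h.cont_A
      (fun _ _ => continuous_const) (fun _ _ => continuous_const) (fun _ _ => continuous_const)
      (a := T) (b := t) (s := T)
      (fun s hs => ((h.deriv_S s hs.1).mul (hkd s)).congr_deriv (by noncomm_ring))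
      (fun s _ => (HasMatDeriv.const 0).congr_deriv (by simp)) ⟨le_rfl, ht⟩
      (by simp only [hkT, mul_colMat, hSk₀, colMat_zero]) rfl t ⟨ht, le_rfl⟩).1
    simp only [mul_colMat] at h1
    ext i
    exact congrFun (congrFun h1 i) 0

/-- Along a kernel solution the quadratic form of the Riccati solution is nonincreasing. -/
theorem hasDerivAt_quadForm_kernel (h : IsGauged c A B C S T) {V : ℝ → Mat2}
    (hV : ∀ t, T ≤ t → (V t).IsHermitian ∧ HasMatDeriv V (c.riccatiRHS t (V t)) t)
    {k : ℝ → Fin 2 → ℂ} (hk : ∀ t, HasMatDeriv (fun t => colMat (k t)) (c.cP t * colMat (k t)) t)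
    (hSk : ∀ t, T ≤ t → S t *ᵥ k t = 0) {t : ℝ} (ht : T ≤ t) :
    HasDerivAt (fun t => -quadForm (V t) (k t))
      (c.d₁ t * ‖(V t *ᵥ k t) 0‖ ^ 2 + c.d₂ t * ‖(V t *ᵥ k t) 1‖ ^ 2) t := by
  have hQk : c.cQ t * colMat (k t) = 0 := by
    rw [h.eq_Q t ht, Matrix.mul_assoc, mul_colMat, hSk t ht, colMat_zero, Matrix.mul_zero]
  have hX : HasMatDeriv (fun t => colMat (k t))
      (c.cP t * colMat (k t) + c.cB t * (0 : Mat2)) t :=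
    (hk t).congr_deriv (by rw [Matrix.mul_zero, add_zero])
  have hU : HasMatDeriv (fun _ => (0 : Mat2))
      (c.cQ t * colMat (k t) - (c.cP t)ᴴ * (0 : Mat2)) t :=
    (HasMatDeriv.const 0).congr_deriv (by rw [hQk, Matrix.mul_zero, sub_zero])
  have hκeq : ∀ t, (((colMat (k t))ᴴ * ((0 : Mat2) - V t * colMat (k t))) 0 0).re =
      -quadForm (V t) (k t) := by
    intro t
    rw [zero_sub, Matrix.mul_neg, Matrix.neg_apply, Complex.neg_re, ← Matrix.mul_assoc,
      re_conjTranspose_mul_mul_apply]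
    rfl
  have hd := GaugedSystem.picone_hasDerivAt (X := fun t => colMat (k t)) (U := fun _ => 0)
    (hV t ht).1 (hV t ht).2 hX hU
  refine (hd.congr_of_eventuallyEq (Eventually.of_forall fun s => (hκeq s).symm)).congr_deriv ?_
  have e : ∀ i, ‖((0 : Mat2) - V t * colMat (k t)) i 0‖ = ‖(V t *ᵥ k t) i‖ := fun i => by
    rw [mul_colMat, zero_sub, Matrix.neg_apply, norm_neg]
    rfl
  rw [e, e]

/-- A global Hermitian solution of the gauged Riccati equation yields a conjoined solution of the
original system that is eventually nondegenerate. -/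
theorem hasNonsingularConjoined (h : IsGauged c A B C S T) {V : ℝ → Mat2}
    (hV : ∀ t, T ≤ t → (V t).IsHermitian ∧ HasMatDeriv V (c.riccatiRHS t (V t)) t) :
    HasNonsingularConjoined A B C := by
  -- Domination without a kernel correction may be verified at any later time `t`, which then
  -- replaces `T`.
  have trivial_k := fun t (ht : T ≤ t) => (h.mono ht).hasNonsingularConjoined_of_quadForm_lt
    (V := V) (fun s hs => hV s (ht.trans hs))
  by_cases hdet : (S T).det = 0
  swap
  · exact trivial_k T le_rfl (exists_quadForm_lt_of_det_ne_zero hdet _)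
  obtain ⟨k, hkd, hk⟩ := h.exists_kernel_solution hdet
  -- If `k* V k` stays positive, shifting by the minimising multiple of `k` replaces `V(T)` by its
  -- Schur complement, which vanishes on `ker S` and is therefore dominated.
  by_cases hpos : ∀ t, T ≤ t → 0 < quadForm (V t) (k t)
  · have hκT := (hpos T le_rfl).ne'
    have hVT := (hV T le_rfl).1
    obtain ⟨r, hr⟩ := exists_quadForm_lt_of_mulVec_eq_zero
      (isHermitian_schurComplement hVT (k T)) (hk T le_rfl).1 (schurComplement_mulVec_self hVT hκT)
      (hk T le_rfl).2
    exact h.exists_nonsingular_of_quadForm_lt hV (fun t _ => hkd t) (fun t ht => (hk t ht).2)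
      (fun t ht => (hpos t ht).le) (r := r)
      (fun x hx => ⟨_, (quadForm_add_smul_eq_schurComplement hVT hκT x).trans_lt (hr x hx)⟩)
  -- If `k* V k` is negative at some time, the Schur complement at that time lies above `V`, so no
  -- shift is needed.
  by_cases hneg : ∃ t, T ≤ t ∧ quadForm (V t) (k t) < 0
  · obtain ⟨t, ht, hlt⟩ := hneg
    have hVt := (hV t ht).1
    obtain ⟨r, hr⟩ := exists_quadForm_lt_of_mulVec_eq_zero
      (isHermitian_schurComplement hVt (k t)) (hk t ht).1 (schurComplement_mulVec_self hVt hlt.ne)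
      (hk t ht).2
    refine trivial_k t ht ⟨r, fun x hx => lt_of_le_of_lt ?_ (hr x hx)⟩
    rw [quadForm_schurComplement hVt]
    have := div_nonpos_of_nonneg_of_nonpos (sq_nonneg ‖star (k t) ⬝ᵥ V t *ᵥ x‖) hlt.le
    linarith
  -- What remains is a nonnegative, nonincreasing `k* V k` that reaches zero and stays there. Its
  -- derivative `-(V k)* 𝓑 (V k)` then vanishes, so `V k = 0` and `V` itself is dominated. The time
  -- `t₁ + 1` has a full neighbourhood in the zero set.
  push Not at hpos hneg
  obtain ⟨t₁, ht₁, hle⟩ := hpos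
  have hd := fun t (ht : T ≤ t) => h.hasDerivAt_quadForm_kernel hV hkd (fun t ht => (hk t ht).2) ht
  have hmono : MonotoneOn (fun t => -quadForm (V t) (k t)) (Ici T) := by
    refine monotoneOn_of_deriv_nonneg (convex_Ici T)
      (fun t ht => (hd t ht).continuousAt.continuousWithinAt)
      (fun t ht => (hd t (interior_subset ht)).differentiableAt.differentiableWithinAt) ?_
    intro t ht
    rw [(hd t (interior_subset ht)).deriv]
    have h1 := c.d₁_pos t
    have h2 := c.d₂_pos t
    positivity
  have hzero : ∀ t, t₁ ≤ t → quadForm (V t) (k t) = 0 := fun t ht => by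
    have h1 := hmono (mem_Ici.2 ht₁) (mem_Ici.2 (ht₁.trans ht)) ht
    have h2 := hneg t (ht₁.trans ht)
    simp only at h1
    linarith
  have ht₂ : T ≤ t₁ + 1 := by linarith
  have hd0 : HasDerivAt (fun t => -quadForm (V t) (k t)) 0 (t₁ + 1) :=
    (hasDerivAt_const _ (0 : ℝ)).congr_of_eventuallyEq
      (eventually_of_mem (Ioi_mem_nhds (lt_add_one t₁)) fun t ht => by simp [hzero t (le_of_lt ht)])
  have hsum := (hd _ ht₂).unique hd0
  have hVk : V (t₁ + 1) *ᵥ k (t₁ + 1) = 0 := by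
    have p1 := c.d₁_pos (t₁ + 1)
    have p2 := c.d₂_pos (t₁ + 1)
    set y := V (t₁ + 1) *ᵥ k (t₁ + 1)
    have q1 : 0 ≤ c.d₁ (t₁ + 1) * ‖y 0‖ ^ 2 := by positivity
    have q2 : 0 ≤ c.d₂ (t₁ + 1) * ‖y 1‖ ^ 2 := by positivity
    have z1 : c.d₁ (t₁ + 1) * ‖y 0‖ ^ 2 = 0 := by linarith
    have z2 : c.d₂ (t₁ + 1) * ‖y 1‖ ^ 2 = 0 := by linarith
    ext i
    fin_cases i
    · simpa [p1.ne'] using z1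
    · simpa [p2.ne'] using z2
  exact trivial_k _ ht₂ (exists_quadForm_lt_of_mulVec_eq_zero (hV _ ht₂).1 (hk _ ht₂).1 hVk
    (hk _ ht₂).2)

end IsGauged

/-! ### Absolutely continuous primitives and running maxima. -/

/-- It passes absolute continuity from the primitive of `‖f‖` to that of a complex `f`, and from a
primitive to its exponential. -/
theorem AbsolutelyContinuousOnInterval.of_dist_le_mul {X Y : Type*} [PseudoMetricSpace X]
    [PseudoMetricSpace Y] {f : ℝ → X} {g : ℝ → Y} {a b K : ℝ}
    (hf : AbsolutelyContinuousOnInterval f a b)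
    (h : ∀ x ∈ uIcc a b, ∀ y ∈ uIcc a b, dist (g x) (g y) ≤ K * dist (f x) (f y)) :
    AbsolutelyContinuousOnInterval g a b := by
  rw [absolutelyContinuousOnInterval_iff] at hf ⊢
  intro ε hε
  obtain ⟨δ, hδ, hfδ⟩ := hf (ε / (|K| + 1)) (by positivity)
  refine ⟨δ, hδ, fun E hE hEδ => ?_⟩
  have h1 := hfδ E hE hEδ
  calc ∑ i ∈ Finset.range E.1, dist (g (E.2 i).1) (g (E.2 i).2)
      ≤ ∑ i ∈ Finset.range E.1, (|K| + 1) * dist (f (E.2 i).1) (f (E.2 i).2) := by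
        refine Finset.sum_le_sum fun i hi => (h _ (hE.1 i hi).1 _ (hE.1 i hi).2).trans ?_
        exact mul_le_mul_of_nonneg_right (by linarith [le_abs_self K]) dist_nonneg
    _ = (|K| + 1) * ∑ i ∈ Finset.range E.1, dist (f (E.2 i).1) (f (E.2 i).2) :=
        (Finset.mul_sum _ _ _).symm
    _ < (|K| + 1) * (ε / (|K| + 1)) := mul_lt_mul_of_pos_left h1 (by positivity)
    _ = ε := by field_simp

/-- The primitive of an integrable complex function is absolutely continuous. -/
theorem IntervalIntegrable.absolutelyContinuousOnInterval_primitive {f : ℝ → ℂ} {a b : ℝ}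
    (h : IntervalIntegrable f volume a b) :
    AbsolutelyContinuousOnInterval (fun x => ∫ v in a..x, f v) a b := by
  refine (h.norm.absolutelyContinuousOnInterval_intervalIntegral
    left_mem_uIcc).of_dist_le_mul (K := 1) fun x hx y hy => ?_
  have hi : ∀ z ∈ uIcc a b, IntervalIntegrable f volume a z := fun z hz =>
    h.mono_set (uIcc_subset_uIcc_left hz)
  rw [one_mul, dist_eq_norm, Real.dist_eq, intervalIntegral.integral_interval_sub_left (hi x hx)
    (hi y hy), intervalIntegral.integral_interval_sub_left (hi x hx).norm (hi y hy).norm]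
  exact intervalIntegral.norm_integral_le_abs_integral_norm

theorem norm_exp_sub_exp_le {R : ℝ} {z w : ℂ} (hz : ‖z‖ ≤ R) (hw : ‖w‖ ≤ R) :
    ‖Complex.exp z - Complex.exp w‖ ≤ Real.exp R * ‖z - w‖ := by
  refine (convex_closedBall (0 : ℂ) R).norm_image_sub_le_of_norm_deriv_le
    (fun x _ => Complex.differentiableAt_exp) (fun x hx => ?_) (by simpa using hw) (by simpa using hz)
  rw [Complex.deriv_exp, Complex.norm_exp]
  exact Real.exp_le_exp.2 ((Complex.re_le_norm x).trans (by simpa using hx))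

/-- `f exp(∫ a)` is a primitive of `(f' + f a) exp(∫ a)` for continuously differentiable `f` and
integrable `a`. -/
theorem mul_exp_primitive_sub {t₀ T : ℝ} (hT : t₀ ≤ T) {a f : ℝ → ℂ}
    (ha : IntervalIntegrable a volume t₀ T) (hf : ContDiffOn ℝ 1 f (Ici t₀)) :
    IntervalIntegrable (fun s => (derivWithin f (Ici t₀) s + f s * a s) *
      Complex.exp (∫ r in t₀..s, a r)) volume t₀ T ∧
    ∀ x ∈ Icc t₀ T, f x * Complex.exp (∫ r in t₀..x, a r) - f t₀ =
      ∫ s in t₀..x, (derivWithin f (Ici t₀) s + f s * a s) * Complex.exp (∫ r in t₀..s, a r) := by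
  set L : ℝ → ℂ := fun x => ∫ r in t₀..x, a r with hL
  have hsub : Icc t₀ T ⊆ Ici t₀ := Icc_subset_Ici_self
  have hu : uIcc t₀ T = Icc t₀ T := uIcc_of_le hT
  have hLac : AbsolutelyContinuousOnInterval L t₀ T :=
    ha.absolutelyContinuousOnInterval_primitive
  obtain ⟨R, hR⟩ := hLac.exists_bound
  have hEac : AbsolutelyContinuousOnInterval (fun x => Complex.exp (L x)) t₀ T := by
    refine hLac.of_dist_le_mul (K := Real.exp R) fun x hx y hy => ?_
    rw [dist_eq_norm, dist_eq_norm]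
    exact norm_exp_sub_exp_le (hR x hx) (hR y hy)
  have hfac : AbsolutelyContinuousOnInterval f t₀ T :=
    (hf.mono (hu ▸ hsub)).absolutelyContinuousOnInterval
  have hf' : ContinuousOn (derivWithin f (Ici t₀)) (uIcc t₀ T) := by
    rw [hu]
    exact (hf.continuousOn_derivWithin (uniqueDiffOn_Ici t₀) le_rfl).mono hsub
  have hfc : ContinuousOn f (uIcc t₀ T) := hfac.continuousOn
  have hg : IntervalIntegrable (fun s => (derivWithin f (Ici t₀) s + f s * a s) *
      Complex.exp (L s)) volume t₀ T :=
    (hf'.intervalIntegrable.add (ha.continuousOn_mul hfc)).mul_continuousOn hEac.continuousOn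
  refine ⟨hg, fun x hx => ?_⟩
  set g : ℝ → ℂ := fun s => (derivWithin f (Ici t₀) s + f s * a s) * Complex.exp (L s) with hgdef
  have hac := (hfac.smul hEac).sub hg.absolutelyContinuousOnInterval_primitive
  have hne : ∀ᵐ x : ℝ, x ≠ t₀ := by simp [ae_iff, measure_singleton]
  -- As `a` is merely integrable, the product is differentiable only almost everywhere; absolute
  -- continuity makes this enough. The point `t₀` is discarded because `f` has only a one-sided
  -- derivative there.
  obtain ⟨K, hK⟩ := hac.const_of_ae_hasDerivAt_zero (by
    filter_upwards [ha.ae_hasDerivAt_integral, hg.ae_hasDerivAt_integral, hne] with y h1 h2 h3 hy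
    have hy0 : t₀ < y := lt_of_le_of_ne (hu ▸ hy).1 (Ne.symm h3)
    have d1 := (h1 hy t₀ left_mem_uIcc).cexp
    have d2 := h2 hy t₀ left_mem_uIcc
    have d3 : HasDerivAt f (derivWithin f (Ici t₀) y) y :=
      (((hf.differentiableOn one_ne_zero) y hy0.le).hasDerivWithinAt).hasDerivAt
        (Ici_mem_nhds hy0)
    refine ((d3.mul d1).sub d2).congr_deriv ?_
    simp only [hgdef, hL]
    ring)
  have k1 := (hK x (hu ▸ hx)).trans (hK t₀ left_mem_uIcc).symm
  change f x * Complex.exp (L x) - ∫ s in t₀..x, g s =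
    f t₀ * Complex.exp (∫ r in t₀..t₀, a r) - ∫ s in t₀..t₀, g s at k1
  rw [intervalIntegral.integral_same, intervalIntegral.integral_same, Complex.exp_zero, mul_one,
    sub_zero] at k1
  linear_combination k1

theorem continuousOn_primitive {E : Type*} [NormedAddCommGroup E] [NormedSpace ℝ E] {t₀ : ℝ}
    {a : ℝ → E} (ha : ∀ T, t₀ ≤ T → IntervalIntegrable a volume t₀ T) :
    ContinuousOn (fun x => ∫ r in t₀..x, a r) (Ici t₀) := by
  intro x hx
  have hx1 : t₀ ≤ x + 1 := (mem_Ici.1 hx).trans (by linarith)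
  have h1 := intervalIntegral.continuousOn_primitive_interval' (ha (x + 1) hx1) left_mem_uIcc
  rw [uIcc_of_le hx1] at h1
  refine (h1 x ⟨hx, by linarith⟩).mono_of_mem_nhdsWithin ?_
  rw [← Ici_inter_Iic]
  exact inter_mem self_mem_nhdsWithin (mem_nhdsWithin_of_mem_nhds (Iic_mem_nhds (by linarith)))

/-- The running maximum of a continuous function is continuous. -/
theorem continuousOn_runningMax {t₀ : ℝ} {g : ℝ → ℝ} (hg : ContinuousOn g (Ici t₀)) :
    ContinuousOn (fun t => sSup (g '' Icc t₀ t)) (Ici t₀) := by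
  have hg' : Continuous fun t => g (max t t₀) := hg.comp_continuous (by fun_prop)
    fun t => mem_Ici.2 (le_max_right _ _)
  -- Rescaling `[t₀, t]` to `[0, 1]` turns the running maximum into a supremum over a fixed compact
  -- set.
  have h1 : Continuous fun t => sSup ((fun u => g (max (t₀ + u * (t - t₀)) t₀)) '' Icc (0 : ℝ) 1) :=
    isCompact_Icc.continuous_sSup (f := fun t u => g (max (t₀ + u * (t - t₀)) t₀))
      (hg'.comp (by fun_prop))
  refine h1.continuousOn.congr fun t ht => ?_
  congr 1
  ext y
  constructor
  · rintro ⟨τ, hτ, rfl⟩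
    rcases (mem_Ici.1 ht).eq_or_lt with h | h
    · refine ⟨0, by simp, ?_⟩
      have : τ = t₀ := le_antisymm (hτ.2.trans h.symm.le) hτ.1
      simp [this]
    · have hp : 0 < t - t₀ := sub_pos.2 h
      refine ⟨(τ - t₀) / (t - t₀), ⟨div_nonneg (sub_nonneg.2 hτ.1) hp.le,
        (div_le_one hp).2 (by linarith [hτ.2])⟩, ?_⟩
      simp only
      rw [div_mul_cancel₀ _ hp.ne', add_sub_cancel, max_eq_left hτ.1]
  · rintro ⟨u, hu, rfl⟩
    have hp : 0 ≤ t - t₀ := sub_nonneg.2 ht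
    have h0 : t₀ ≤ t₀ + u * (t - t₀) := by nlinarith [hu.1]
    exact ⟨t₀ + u * (t - t₀), ⟨h0, by nlinarith [hu.2]⟩, by simp only [max_eq_left h0]⟩

/-! ### From the integral conditions to the gauged Riccati equation. -/

namespace Ham

/-- The integral condition along the sequence implies persistence of positivity for the Riccati
inequality, in the variables obtained by removing the linear term. -/
theorem SeqCond.positivityPersists {t₀ : ℝ} {g χ d h : ℝ → ℝ} (hs : SeqCond t₀ g χ)
    (hg : ∀ T, t₀ ≤ T → IntervalIntegrable g volume t₀ T) (hd : Continuous d) (hh : Continuous h)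
    (hdg : ∀ t, t₀ ≤ t → d t = Real.exp (-∫ s in t₀..t, g s)) (hd0 : ∀ t, 0 ≤ d t)
    (hχ : ∀ t, t₀ ≤ t → χ t = d t * h t) :
    ∃ T₀, t₀ < T₀ ∧ ∀ T, T₀ ≤ T → PositivityPersists T d h := by
  obtain ⟨ξ, hξ0, hξ, hξt, hcond⟩ := hs
  have hξt₀ : ∀ m, t₀ ≤ ξ m := fun m => hξ0 ▸ hξ.monotone (Nat.zero_le m)
  have hgi : ∀ a b, t₀ ≤ a → t₀ ≤ b → IntervalIntegrable g volume a b := fun a b ha hb =>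
    (hg a ha).symm.trans (hg b hb)
  have hexp : ∀ a b, t₀ ≤ a → t₀ ≤ b → Real.exp (-∫ s in a..b, g s) * d a = d b := by
    intro a b ha hb
    rw [hdg a ha, hdg b hb, ← Real.exp_add,
      ← intervalIntegral.integral_add_adjacent_intervals (hgi t₀ a le_rfl ha) (hgi a b ha hb)]
    congr 1; ring
  have hexp' : ∀ a b, t₀ ≤ a → t₀ ≤ b → Real.exp (∫ s in a..b, g s) * d b = d a := by
    intro a b ha hb
    rw [← hexp a b ha hb, ← mul_assoc, ← Real.exp_add]
    simp
  have hI : ∀ m, ∀ s, ξ m ≤ s → I g χ (ξ m) s = d s * ∫ r in ξ m..s, h r := by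
    intro m s hs
    rw [I, ← intervalIntegral.integral_const_mul]
    refine intervalIntegral.integral_congr fun τ hτ => ?_
    rw [uIcc_of_le hs] at hτ
    have hτ0 : t₀ ≤ τ := (hξt₀ m).trans hτ.1
    rw [hχ τ hτ0, ← mul_assoc, hexp τ s hτ0 (hτ0.trans hτ.2)]
  have hsub : ∀ m, ∃ z z' : ℝ → ℝ, 1 ≤ m → z (ξ m) = 0 ∧ (∀ t, HasDerivAt z (z' t) t) ∧
      ∀ t ∈ Icc (ξ m) (ξ (m + 1)), 0 ≤ z t ∧ z' t ≤ -d t * z t ^ 2 - h t := by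
    intro m
    by_cases hm : 1 ≤ m
    swap
    · exact ⟨0, 0, fun h => absurd h hm⟩
    obtain ⟨z, z', hz⟩ := exists_nonneg_riccati_subsolution hd hh hd0 (hξ m.lt_succ_self) (by
      intro t ht
      have h1 := hcond m hm t ht
      -- With `d = exp(-∫ g)` and `χ = d h`, one has `I(ξₘ, s) = d(s) ∫ h` and `exp(∫ g) d(τ) =
      -- d(ξₘ)`. The linear term disappears up to the positive constant `d(ξₘ)`.
      have h2 : ∫ τ in ξ m..t, Real.exp (∫ s in ξ m..τ, (g s - I g χ (ξ m) s)) * χ τ =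
          d (ξ m) * ∫ τ in ξ m..t,
            Real.exp (-∫ s in ξ m..τ, d s * ∫ r in ξ m..s, h r) * h τ := by
        rw [← intervalIntegral.integral_const_mul]
        refine intervalIntegral.integral_congr fun τ hτ => ?_
        rw [uIcc_of_le ht.1] at hτ
        have hτ0 : t₀ ≤ τ := (hξt₀ m).trans hτ.1
        have hJ : Continuous fun s => d s * ∫ r in ξ m..s, h r :=
          hd.mul (intervalIntegral.continuous_primitive (fun a b => hh.intervalIntegrable a b) _)
        have h3 : ∫ s in ξ m..τ, (g s - I g χ (ξ m) s) =
            (∫ s in ξ m..τ, g s) - ∫ s in ξ m..τ, d s * ∫ r in ξ m..s, h r := by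
          rw [← intervalIntegral.integral_sub (hgi _ _ (hξt₀ m) hτ0) (hJ.intervalIntegrable _ _)]
          refine intervalIntegral.integral_congr fun s hs => ?_
          rw [uIcc_of_le hτ.1] at hs
          rw [hI m s hs.1]
        rw [h3, sub_eq_add_neg, Real.exp_add, hχ τ hτ0, ← hexp' (ξ m) τ (hξt₀ m) hτ0]
        ring
      rw [h2] at h1
      have hdpos : 0 < d (ξ m) := by rw [hdg _ (hξt₀ m)]; exact Real.exp_pos _
      exact nonpos_of_mul_nonpos_right h1 hdpos)
    exact ⟨z, z', fun _ => hz⟩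
  choose z z' hz using hsub
  refine ⟨ξ 1, hξ0 ▸ hξ one_pos, fun T hT => positivityPersists_of_subsolutions hd hξ hξt
    (fun m hm => (hz m hm).1) (fun m hm => (hz m hm).2.1) (fun m hm => (hz m hm).2.2) hT⟩

/-- The regularity used to remove the diagonal of `p`. -/
structure GaugeData (t₀ : ℝ) (p q : ℝ → Mat2) : Prop where
  diag : ∀ j, ∀ T, t₀ ≤ T → IntervalIntegrable (fun t => p t j j) volume t₀ T
  p12 : ContDiffOn ℝ 1 (fun t => p t 0 1) (Ici t₀)
  p21 : ContDiffOn ℝ 1 (fun t => p t 1 0) (Ici t₀)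
  contq : ContEntries t₀ q
  hermq : ∀ t, t₀ ≤ t → (q t).IsHermitian

/-- The primitive of a diagonal entry, frozen to the left of `t₀`. -/
noncomputable def diagPrim (t₀ : ℝ) (p : ℝ → Mat2) (j : Fin 2) (t : ℝ) : ℂ :=
  ∫ s in t₀..max t t₀, p s j j

/-- `exp ∫ (conj p₁₁ + p₂₂)`. -/
noncomputable def expTrace (t₀ : ℝ) (p : ℝ → Mat2) (t : ℝ) : ℂ :=
  Complex.exp (conj (diagPrim t₀ p 0 t) + diagPrim t₀ p 1 t)

/-- `exp (-2 Re ∫ pⱼⱼ)`. -/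
noncomputable def damp (t₀ : ℝ) (p : ℝ → Mat2) (j : Fin 2) (t : ℝ) : ℝ :=
  Real.exp (-(2 * (diagPrim t₀ p j t).re))

theorem continuous_comp_max {t₀ : ℝ} {E : Type*} [TopologicalSpace E] {f : ℝ → E}
    (hf : ContinuousOn f (Ici t₀)) : Continuous fun t => f (max t t₀) :=
  hf.comp_continuous (by fun_prop) fun t => mem_Ici.2 (le_max_right _ _)

theorem expTrace_eq_mul (t₀ : ℝ) (p : ℝ → Mat2) (t : ℝ) :
    expTrace t₀ p t = conj (Complex.exp (diagPrim t₀ p 0 t)) * Complex.exp (diagPrim t₀ p 1 t) := by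
  rw [expTrace, Complex.exp_add, Complex.exp_conj]

theorem damp_mul_exp (t₀ : ℝ) (p : ℝ → Mat2) (j : Fin 2) (t : ℝ) :
    (damp t₀ p j t : ℂ) *
      (Complex.exp (diagPrim t₀ p j t) * conj (Complex.exp (diagPrim t₀ p j t))) = 1 := by
  rw [damp, ← Complex.exp_conj, ← Complex.exp_add, Complex.add_conj, Complex.ofReal_exp,
    ← Complex.exp_add]
  simp

theorem damp_mul_norm_sq (t₀ : ℝ) (p : ℝ → Mat2) (j : Fin 2) (t : ℝ) :
    damp t₀ p j t * ‖Complex.exp (diagPrim t₀ p j t)‖ ^ 2 = 1 := by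
  rw [damp, Complex.norm_exp, ← Real.exp_nat_mul, ← Real.exp_add]
  simp

theorem damp_mul_damp_mul (t₀ : ℝ) (p : ℝ → Mat2) (t : ℝ) :
    damp t₀ p 0 t * damp t₀ p 1 t * ‖expTrace t₀ p t‖ ^ 2 = 1 := by
  have h0 := damp_mul_norm_sq t₀ p 0 t
  have h1 := damp_mul_norm_sq t₀ p 1 t
  rw [expTrace_eq_mul, norm_mul, RCLike.norm_conj, mul_pow]
  linear_combination damp t₀ p 1 t * ‖Complex.exp (diagPrim t₀ p 1 t)‖ ^ 2 * h0 + h1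

namespace GaugeData

variable {t₀ : ℝ} {p q : ℝ → Mat2}

theorem conj_integrable (h : GaugeData t₀ p q) (j : Fin 2) (T : ℝ) (hT : t₀ ≤ T) :
    IntervalIntegrable (fun s => conj (p s j j)) volume t₀ T :=
  ⟨(Complex.conjCLE : ℂ →L[ℝ] ℂ).integrable_comp (h.diag j T hT).1,
    (Complex.conjCLE : ℂ →L[ℝ] ℂ).integrable_comp (h.diag j T hT).2⟩

theorem trace_integrable (h : GaugeData t₀ p q) (T : ℝ) (hT : t₀ ≤ T) :
    IntervalIntegrable (fun s => conj (p s 0 0) + p s 1 1) volume t₀ T :=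
  (h.conj_integrable 0 T hT).add (h.diag 1 T hT)

theorem re_integrable (h : GaugeData t₀ p q) (j : Fin 2) (T : ℝ) (hT : t₀ ≤ T) :
    IntervalIntegrable (fun s => 2 * (p s j j).re) volume t₀ T :=
  IntervalIntegrable.const_mul ⟨Complex.reCLM.integrable_comp (h.diag j T hT).1,
    Complex.reCLM.integrable_comp (h.diag j T hT).2⟩ 2

theorem continuous_diagPrim (h : GaugeData t₀ p q) (j : Fin 2) : Continuous (diagPrim t₀ p j) :=
  continuous_comp_max (continuousOn_primitive (h.diag j))

theorem continuous_expTrace (h : GaugeData t₀ p q) : Continuous (expTrace t₀ p) :=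
  ((Complex.continuous_conj.comp (h.continuous_diagPrim 0)).add (h.continuous_diagPrim 1)).cexp

theorem continuous_damp (h : GaugeData t₀ p q) (j : Fin 2) : Continuous (damp t₀ p j) :=
  (continuous_const.mul (Complex.continuous_re.comp (h.continuous_diagPrim j))).neg.rexp

theorem expTrace_eq (h : GaugeData t₀ p q) {t : ℝ} (ht : t₀ ≤ t) :
    expTrace t₀ p t = Complex.exp (∫ s in t₀..t, (conj (p s 0 0) + p s 1 1)) := by
  rw [expTrace, diagPrim, diagPrim, max_eq_left ht,
    intervalIntegral.integral_add (h.conj_integrable 0 t ht) (h.diag 1 t ht),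
    intervalIntegral.intervalIntegral_conj]

theorem damp_eq (h : GaugeData t₀ p q) (j : Fin 2) {t : ℝ} (ht : t₀ ≤ t) :
    damp t₀ p j t = Real.exp (-∫ s in t₀..t, 2 * (p s j j).re) := by
  rw [damp, diagPrim, max_eq_left ht, intervalIntegral.integral_const_mul]
  congr 3
  exact (intervalIntegral.intervalIntegral_re (h.diag j t ht)).symm

theorem expTrace_mul_kern (h : GaugeData t₀ p q) {τ t : ℝ} (hτ : t₀ ≤ τ) (ht : t₀ ≤ t) :
    expTrace t₀ p t * kern p τ t = expTrace t₀ p τ := by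
  have h1 := h.trace_integrable
  rw [h.expTrace_eq ht, h.expTrace_eq hτ, kern, ← Complex.exp_add,
    ← intervalIntegral.integral_interval_sub_left (h1 t ht) (h1 τ hτ)]
  congr 1
  ring

/-- The gauged hamiltonian system. -/
noncomputable def system (h : GaugeData t₀ p q) : GaugedSystem where
  d₁ := damp t₀ p 0
  d₂ := damp t₀ p 1
  α t := expTrace t₀ p t * p (max t t₀) 0 1
  β t := expTrace t₀ p t * conj (p (max t t₀) 1 0)
  κ t := expTrace t₀ p t * q (max t t₀) 0 1
  q₁ t := ‖Complex.exp (diagPrim t₀ p 0 t)‖ ^ 2 * (q (max t t₀) 0 0).re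
  q₂ t := ‖Complex.exp (diagPrim t₀ p 1 t)‖ ^ 2 * (q (max t t₀) 1 1).re
  cont_d₁ := h.continuous_damp 0
  cont_d₂ := h.continuous_damp 1
  cont_α := h.continuous_expTrace.mul (continuous_comp_max h.p12.continuousOn)
  cont_β := h.continuous_expTrace.mul
    (Complex.continuous_conj.comp (continuous_comp_max h.p21.continuousOn))
  cont_κ := h.continuous_expTrace.mul (continuous_comp_max (h.contq 0 1))
  cont_q₁ := (((h.continuous_diagPrim 0).cexp).norm.pow 2).mul
    (Complex.continuous_re.comp (continuous_comp_max (h.contq 0 0)))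
  cont_q₂ := (((h.continuous_diagPrim 1).cexp).norm.pow 2).mul
    (Complex.continuous_re.comp (continuous_comp_max (h.contq 1 1)))
  d₁_pos _ := Real.exp_pos _
  d₂_pos _ := Real.exp_pos _

/-- The integrand of `remInt`, multiplied by `exp ∫ (conj p₁₁ + p₂₂)`. -/
noncomputable def remDensity (t₀ : ℝ) (p q : ℝ → Mat2) (w : ℝ → ℂ) (s : ℝ) : ℂ :=
  expTrace t₀ p s *
    (derivWithin w (Ici t₀) s + w s * (conj (p s 0 0) + p s 1 1) + q s 0 1)

/-- `exp ∫ (conj p₁₁ + p₂₂)` times the two terms of the majorant, continued by the value at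
`t₀`. -/
noncomputable def radius (t₀ : ℝ) (p q : ℝ → Mat2) (w : ℝ → ℂ) (t : ℝ) : ℝ :=
  sSup ((fun τ => ‖expTrace t₀ p τ * (p τ 0 1 - conj (p τ 1 0))‖) '' Icc t₀ (max t t₀)) +
    ∫ s in t₀..max t t₀, ‖remDensity t₀ p q w s‖

theorem continuousOn_gap (h : GaugeData t₀ p q) :
    ContinuousOn (fun τ => ‖expTrace t₀ p τ * (p τ 0 1 - conj (p τ 1 0))‖) (Ici t₀) :=
  (h.continuous_expTrace.continuousOn.mul (h.p12.continuousOn.sub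
    (Complex.continuous_conj.comp_continuousOn h.p21.continuousOn))).norm

/-- The kernel is the quotient of `expTrace` at `τ` and at `t`, so multiplication by the value at
`t` leaves integrands independent of `t`. -/
theorem norm_expTrace_mul_majorant (h : GaugeData t₀ p q) (w : ℝ → ℂ) {t : ℝ} (ht : t₀ ≤ t) :
    ‖expTrace t₀ p t‖ * (maj t₀ p t + remInt t₀ p q w t) = radius t₀ p q w t := by
  have hk : ∀ τ, t₀ ≤ τ → ∀ z : ℂ,
      ‖expTrace t₀ p t‖ * ‖kern p τ t * z‖ = ‖expTrace t₀ p τ * z‖ := fun τ hτ z => by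
    rw [← norm_mul, ← mul_assoc, h.expTrace_mul_kern hτ ht]
  rw [radius, mul_add, max_eq_left ht, maj, remInt, ← intervalIntegral.integral_const_mul]
  congr 1
  · rw [← smul_eq_mul, ← Real.sSup_smul_of_nonneg (norm_nonneg _), ← image_smul, image_image]
    congr 1
    refine image_congr fun τ hτ => ?_
    rw [smul_eq_mul, hk τ hτ.1]
  · refine intervalIntegral.integral_congr fun τ hτ => ?_
    rw [uIcc_of_le ht] at hτ
    exact hk τ hτ.1 _

/-- The bracket in `remInt`, times `expTrace`, is almost everywhere the derivative of `expTrace · w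
+ ∫ expTrace · q₁₂`. This is where the differentiability of `p₁₂` and `p₂₁` enters. -/
theorem remDensity_integrable (h : GaugeData t₀ p q) {w : ℝ → ℂ}
    (hw : ContDiffOn ℝ 1 w (Ici t₀)) :
    (∀ T, t₀ ≤ T → IntervalIntegrable (remDensity t₀ p q w) volume t₀ T) ∧
    ∀ t, t₀ ≤ t → ∫ s in t₀..t, remDensity t₀ p q w s =
      expTrace t₀ p t * w t - w t₀ + ∫ s in t₀..t, expTrace t₀ p s * q s 0 1 := by
  have key : ∀ T, t₀ ≤ T → ∀ s ∈ uIcc t₀ T,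
      (derivWithin w (Ici t₀) s + w s * (conj (p s 0 0) + p s 1 1)) *
        Complex.exp (∫ r in t₀..s, (conj (p r 0 0) + p r 1 1)) + expTrace t₀ p s * q s 0 1 =
      remDensity t₀ p q w s := by
    intro T hT s hs
    rw [uIcc_of_le hT] at hs
    rw [remDensity, h.expTrace_eq hs.1]
    ring
  have hq : ∀ T, t₀ ≤ T →
      IntervalIntegrable (fun s => expTrace t₀ p s * q s 0 1) volume t₀ T := fun T hT => by
    refine ContinuousOn.intervalIntegrable ?_
    rw [uIcc_of_le hT]
    exact (h.continuous_expTrace.continuousOn.mul (h.contq 0 1)).mono Icc_subset_Ici_self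
  refine ⟨fun T hT => ?_, fun t ht => ?_⟩
  · obtain ⟨h1, _⟩ := mul_exp_primitive_sub hT (h.trace_integrable T hT) hw
    refine (h1.add (hq T hT)).congr fun s hs => ?_
    exact key T hT s (uIoc_subset_uIcc hs)
  · obtain ⟨h1, h2⟩ := mul_exp_primitive_sub ht (h.trace_integrable t ht) hw
    rw [← intervalIntegral.integral_congr (key t ht), intervalIntegral.integral_add h1 (hq t ht),
      ← h2 t ⟨ht, le_rfl⟩, h.expTrace_eq ht]
    ring

theorem continuous_radius (h : GaugeData t₀ p q) {w : ℝ → ℂ} (hw : ContDiffOn ℝ 1 w (Ici t₀)) :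
    Continuous (radius t₀ p q w) :=
  (continuous_comp_max (continuousOn_runningMax h.continuousOn_gap)).add
    (continuous_comp_max (continuousOn_primitive
      fun T hT => ((h.remDensity_integrable hw).1 T hT).norm))

/-- The gap at `τ` is one of the values in the maximum over `[t₀, t]`, and the drift is the integral
of `remDensity` over `[τ, t]`, bounded by that of its norm over all of `[t₀, t]`. -/
theorem gap_add_drift_le_radius (h : GaugeData t₀ p q) {w : ℝ → ℂ}
    (hw : ContDiffOn ℝ 1 w (Ici t₀)) {τ t : ℝ} (hτ : t₀ ≤ τ) (hτt : τ ≤ t) :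
    ‖h.system.α τ - h.system.β τ‖ + ‖expTrace t₀ p t * w t - expTrace t₀ p τ * w τ
      + ∫ s in τ..t, h.system.κ s‖ ≤ radius t₀ p q w t := by
  obtain ⟨h1, h2⟩ := h.remDensity_integrable hw
  have ht := hτ.trans hτt
  rw [radius, max_eq_left ht]
  refine add_le_add ?_ ?_
  · refine le_csSup ?_ ⟨τ, ⟨hτ, hτt⟩, ?_⟩
    · exact (isCompact_Icc.image_of_continuousOn
        (h.continuousOn_gap.mono Icc_subset_Ici_self)).bddAbove
    · simp only [system, max_eq_left hτ, mul_sub]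
  · have e1 : ∫ s in τ..t, h.system.κ s = ∫ s in τ..t, expTrace t₀ p s * q s 0 1 := by
      refine intervalIntegral.integral_congr fun s hs => ?_
      rw [uIcc_of_le hτt] at hs
      simp only [system, max_eq_left (hτ.trans hs.1)]
    have hq : ∀ T, t₀ ≤ T →
        IntervalIntegrable (fun s => expTrace t₀ p s * q s 0 1) volume t₀ T := fun T hT => by
      refine ContinuousOn.intervalIntegrable ?_
      rw [uIcc_of_le hT]
      exact (h.continuous_expTrace.continuousOn.mul (h.contq 0 1)).mono Icc_subset_Ici_self
    have e2 : expTrace t₀ p t * w t - expTrace t₀ p τ * w τ + ∫ s in τ..t, h.system.κ s =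
        ∫ s in τ..t, remDensity t₀ p q w s := by
      rw [e1, ← intervalIntegral.integral_interval_sub_left (h1 t ht) (h1 τ hτ),
        ← intervalIntegral.integral_interval_sub_left (hq t ht) (hq τ hτ), h2 t ht, h2 τ hτ]
      ring
    rw [e2]
    refine (intervalIntegral.norm_integral_le_integral_norm hτt).trans ?_
    rw [← intervalIntegral.integral_interval_sub_left (h1 t ht).norm (h1 τ hτ).norm]
    have := intervalIntegral.integral_nonneg (f := fun s => ‖remDensity t₀ p q w s‖) (μ := volume)
      hτ fun s _ => norm_nonneg _
    linarith

theorem contDiffOn_conj_p21 (h : GaugeData t₀ p q) :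
    ContDiffOn ℝ 1 (fun τ => conj (p τ 1 0)) (Ici t₀) :=
  (Complex.conjCLE : ℂ →L[ℝ] ℂ).contDiff.comp_contDiffOn h.p21

/-- The integral conditions give a global Riccati solution of the gauged system. -/
theorem exists_riccati (h : GaugeData t₀ p q)
    (h₃ : SeqCond t₀ (fun t => 2 * (p t 0 0).re) (chi3 t₀ p q))
    (h₄ : SeqCond t₀ (fun t => 2 * (p t 1 1).re) (chi4 t₀ p q)) :
    ∃ (T : ℝ) (V : ℝ → Mat2), t₀ < T ∧ ∀ t, T ≤ t → (V t).IsHermitian ∧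
      HasMatDeriv V (h.system.riccatiRHS t (V t)) t := by
  set c := h.system with hc
  set R₃ := radius t₀ p q fun τ => conj (p τ 1 0) with hR₃
  set R₄ := radius t₀ p q fun τ => p τ 0 1 with hR₄
  have hR₃c : Continuous R₃ := h.continuous_radius h.contDiffOn_conj_p21
  have hR₄c : Continuous R₄ := h.continuous_radius h.p12
  have hdd := damp_mul_damp_mul t₀ p
  have hD := damp_mul_norm_sq t₀ p
  -- `d₁ h = χ̃₃` because `d₁ d₂ |expTrace|² = 1` and `d₁ |exp ∫ p₁₁|² = 1`; the second condition is
  -- symmetric.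
  obtain ⟨T₃, hT₃, hp₃⟩ := h₃.positivityPersists (d := c.d₁)
    (h := fun t => c.d₂ t * R₃ t ^ 2 - c.d₂ t * ‖c.β t‖ ^ 2 - c.q₁ t) (h.re_integrable 0)
    c.cont_d₁ (((c.cont_d₂.mul (hR₃c.pow 2)).sub (c.cont_d₂.mul (c.cont_β.norm.pow 2))).sub
      c.cont_q₁) (fun t ht => h.damp_eq 0 ht) (fun t => (c.d₁_pos t).le) (by
      intro t ht
      simp only [hR₃, chi3]
      rw [← h.norm_expTrace_mul_majorant _ ht]
      simp only [hc, system, max_eq_left ht, norm_mul, RCLike.norm_conj]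
      set M := maj t₀ p t + remInt t₀ p q (fun τ => conj (p τ 1 0)) t
      linear_combination (‖p t 1 0‖ ^ 2 - M ^ 2) * hdd t + (q t 0 0).re * hD 0 t)
  obtain ⟨T₄, hT₄, hp₄⟩ := h₄.positivityPersists (d := c.d₂)
    (h := fun t => c.d₁ t * R₄ t ^ 2 - c.d₁ t * ‖c.α t‖ ^ 2 - c.q₂ t) (h.re_integrable 1)
    c.cont_d₂ (((c.cont_d₁.mul (hR₄c.pow 2)).sub (c.cont_d₁.mul (c.cont_α.norm.pow 2))).sub
      c.cont_q₂) (fun t ht => h.damp_eq 1 ht) (fun t => (c.d₂_pos t).le) (by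
      intro t ht
      simp only [hR₄, chi4]
      rw [← h.norm_expTrace_mul_majorant _ ht]
      simp only [hc, system, max_eq_left ht, norm_mul]
      set M := maj t₀ p t + remInt t₀ p q (fun τ => p τ 0 1) t
      linear_combination (‖p t 0 1‖ ^ 2 - M ^ 2) * hdd t + (q t 1 1).re * hD 1 t)
  have hT : t₀ < max T₃ T₄ := hT₃.trans_le (le_max_left _ _)
  obtain ⟨V, hV⟩ := GaugedSystem.exists_global_riccati (c := c) (T := max T₃ T₄) (R₃ := R₃)
    (R₄ := R₄)
    (fun τ t hτ hτt => by
      have hτ0 : t₀ ≤ τ := hT.le.trans hτ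
      have := h.gap_add_drift_le_radius h.contDiffOn_conj_p21 hτ0 hτt
      simpa only [hc, system, max_eq_left hτ0, max_eq_left (hτ0.trans hτt)] using this)
    (fun τ t hτ hτt => by
      have hτ0 : t₀ ≤ τ := hT.le.trans hτ
      have := h.gap_add_drift_le_radius h.p12 hτ0 hτt
      simpa only [hc, system, max_eq_left hτ0, max_eq_left (hτ0.trans hτt)] using this)
    (fun _ _ => rfl) (fun _ _ => rfl) (hp₃ _ (le_max_left _ _)) (hp₄ _ (le_max_right _ _))
  exact ⟨_, V, hT, hV⟩

end GaugeData

end Ham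

/-! ### The gauge factor and the conclusion. -/

namespace Ham

theorem sqrtB_mul_self {B : ℝ → Mat2} {t : ℝ} (hB : (B t).PosSemidef) :
    sqrtB B t * sqrtB B t = B t :=
  CFC.sqrt_mul_sqrt_self (B t) hB.nonneg

theorem isHermitian_sqrtB (B : ℝ → Mat2) (t : ℝ) : (sqrtB B t).IsHermitian :=
  (Matrix.nonneg_iff_posSemidef.1 (CFC.sqrt_nonneg (B t))).isHermitian

/-- The factor `√B diag(exp ∫ p₁₁, exp ∫ p₂₂)`, frozen to the left of `t₀`. -/
noncomputable def gaugeFactor (t₀ : ℝ) (B p : ℝ → Mat2) (t : ℝ) : Mat2 :=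
  Matrix.of fun i j => sqrtB B (max t t₀) i j * Complex.exp (diagPrim t₀ p j t)

theorem gaugeFactor_eq_mul (t₀ : ℝ) (B p : ℝ → Mat2) {t : ℝ} (ht : t₀ ≤ t) :
    gaugeFactor t₀ B p t =
      sqrtB B t * Matrix.diagonal fun j => Complex.exp (diagPrim t₀ p j t) := by
  ext i j
  rw [Matrix.mul_diagonal, gaugeFactor, Matrix.of_apply, max_eq_left ht]

variable {t₀ : ℝ} {A B C F q : ℝ → Mat2}

theorem sqrtB_mul_P (hF : SolvesFactorEq t₀ A B F) {t : ℝ} (ht : t₀ ≤ t) :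
    sqrtB B t * P t₀ A B F t = A t * sqrtB B t - matDeriv t₀ (sqrtB B) t := by
  rw [P, ← mul_assoc, hF t ht, G]

/-- The exponentials are differentiable only almost everywhere, but in `S'` the diagonal entries of
`P` cancel against those in `√B P = A√B - (√B)'`. Hence `S` is a primitive of a continuous function
and is differentiable at every `t > t₀`. -/
theorem hasMatDeriv_gaugeFactor (h : GaugeData t₀ (P t₀ A B F) q) (hA : ContEntries t₀ A)
    (hsqrt : C1Entries t₀ (sqrtB B)) (hF : SolvesFactorEq t₀ A B F) {t : ℝ} (ht : t₀ < t) :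
    HasMatDeriv (gaugeFactor t₀ B (P t₀ A B F))
      (A t * gaugeFactor t₀ B (P t₀ A B F) t - gaugeFactor t₀ B (P t₀ A B F) t * h.system.cP t)
      t := by
  set p := P t₀ A B F with hp
  set S := gaugeFactor t₀ B p with hS
  have hScont : ∀ i j, Continuous fun t => S t i j := fun i j =>
    (continuous_comp_max (hsqrt i j).continuousOn).mul (h.continuous_diagPrim j).cexp
  have hAcont : ∀ i j, Continuous fun t => A (max t t₀) i j := fun i j =>
    continuous_comp_max (hA i j)
  intro i j
  set g : ℝ → ℂ := fun s => (A (max s t₀) * S s - S s * h.system.cP s) i j with hg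
  have hgc : Continuous g := by
    simp only [hg, Matrix.sub_apply, Matrix.mul_apply]
    exact (continuous_finsetSum _ fun k _ => (hAcont i k).mul (hScont k j)).sub
      (continuous_finsetSum _ fun k _ => (hScont i k).mul (h.system.continuous_cP k j))
  have key : ∀ s, t₀ ≤ s →
      (derivWithin (fun s => sqrtB B s i j) (Ici t₀) s + sqrtB B s i j * p s j j) *
        Complex.exp (∫ r in t₀..s, p r j j) = g s := by
    intro s hs
    have e1 := congrFun (congrFun (sqrtB_mul_P hF hs) i) j
    rw [← hp] at e1
    have e2 : Complex.exp (∫ r in t₀..s, p r j j) = Complex.exp (diagPrim t₀ p j s) := by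
      rw [diagPrim, max_eq_left hs]
    have d0 := damp_mul_exp t₀ p 0 s
    have d1 := damp_mul_exp t₀ p 1 s
    rw [e2, hg]
    simp only [Matrix.sub_apply, Matrix.mul_apply, Fin.sum_univ_two, matDeriv,
      Matrix.of_apply] at e1
    simp only [hS, gaugeFactor, GaugedSystem.cP, GaugeData.system, expTrace_eq_mul,
      Matrix.sub_apply, Matrix.mul_apply, Fin.sum_univ_two, Matrix.of_apply, max_eq_left hs]
    set E0 := Complex.exp (diagPrim t₀ p 0 s)
    set E1 := Complex.exp (diagPrim t₀ p 1 s)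
    fin_cases j
    · simp at e1 ⊢
      linear_combination E0 * e1 + sqrtB B s i 1 * p s 1 0 * E0 * d1
    · simp at e1 ⊢
      linear_combination E1 * e1 + sqrtB B s i 0 * p s 0 1 * E1 * d0
  have hSint : ∀ s, t₀ ≤ s → S s i j = sqrtB B t₀ i j + ∫ r in t₀..s, g r := by
    intro s hs
    have h1 := (mul_exp_primitive_sub hs (h.diag j s hs) (hsqrt i j)).2 s ⟨hs, le_rfl⟩
    rw [intervalIntegral.integral_congr (g := g) fun r hr => key r (by
      rw [uIcc_of_le hs] at hr; exact hr.1)] at h1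
    rw [← h1]
    simp only [hS, gaugeFactor, Matrix.of_apply, max_eq_left hs, diagPrim]
    ring
  have h1 : HasDerivAt (fun s => sqrtB B t₀ i j + ∫ r in t₀..s, g r) (g t) t :=
    (intervalIntegral.integral_hasDerivAt_right (hgc.intervalIntegrable _ _)
      hgc.aestronglyMeasurable.stronglyMeasurableAtFilter hgc.continuousAt).const_add _
  have h2 := h1.congr_of_eventuallyEq
    (eventually_of_mem (Ici_mem_nhds ht) fun s hs => hSint s hs)
  refine h2.congr_deriv ?_
  simp only [hg, max_eq_left ht.le]

theorem gaugeData_of_factor (hC : ContEntries t₀ C) (hCherm : ∀ t, t₀ ≤ t → (C t).IsHermitian)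
    (hsqrt : C1Entries t₀ (sqrtB B))
    (hPdiag : ∀ j, ∀ T, t₀ ≤ T → IntervalIntegrable (fun t => P t₀ A B F t j j) volume t₀ T)
    (hp12 : ContDiffOn ℝ 1 (fun t => P t₀ A B F t 0 1) (Ici t₀))
    (hp21 : ContDiffOn ℝ 1 (fun t => P t₀ A B F t 1 0) (Ici t₀)) :
    GaugeData t₀ (P t₀ A B F) (Q B C) where
  diag := hPdiag
  p12 := hp12
  p21 := hp21
  contq i j := by
    simp only [Q, Matrix.mul_apply]
    exact continuousOn_finsetSum _ fun k _ => (continuousOn_finsetSum _ fun l _ =>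
      (hsqrt i l).continuousOn.mul (hC l k)).mul (hsqrt k j).continuousOn
  hermq t ht := by
    rw [Matrix.IsHermitian, Q, Matrix.conjTranspose_mul, Matrix.conjTranspose_mul,
      (isHermitian_sqrtB B t).eq, (hCherm t ht).eq, mul_assoc]

/-- With `D = diag(exp ∫ pⱼⱼ)`, the relation `D 𝓑 D* = 1` gives `B = √B √B = S 𝓑 S*`. Freezing the
coefficients to the left of `t₀` makes them continuous on the whole line. -/
theorem isGauged (h : GaugeData t₀ (P t₀ A B F) (Q B C)) (hA : ContEntries t₀ A)
    (hB : ContEntries t₀ B) (hC : ContEntries t₀ C)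
    (hCherm : ∀ t, t₀ ≤ t → (C t).IsHermitian) (hBpos : ∀ t, t₀ ≤ t → (B t).PosSemidef)
    (hsqrt : C1Entries t₀ (sqrtB B)) (hF : SolvesFactorEq t₀ A B F) {T : ℝ} (hT : t₀ < T) :
    IsGauged h.system (fun t => A (max t t₀)) (fun t => B (max t t₀)) (fun t => C (max t t₀))
      (gaugeFactor t₀ B (P t₀ A B F)) T where
  cont_A i j := continuous_comp_max (hA i j)
  cont_B i j := continuous_comp_max (hB i j)
  cont_C i j := continuous_comp_max (hC i j)
  cont_S i j := (continuous_comp_max (hsqrt i j).continuousOn).mul (h.continuous_diagPrim j).cexp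
  herm_B t := (hBpos _ (le_max_right _ _)).isHermitian
  herm_C t := hCherm _ (le_max_right _ _)
  deriv_S t ht := by
    have := hasMatDeriv_gaugeFactor h hA hsqrt hF (hT.trans_le ht)
    simpa only [max_eq_left (hT.le.trans ht)] using this
  eq_B t ht := by
    have ht0 := hT.le.trans ht
    have hD : (Matrix.diagonal fun j => Complex.exp (diagPrim t₀ (P t₀ A B F) j t)) *
        h.system.cB t * (Matrix.diagonal fun j =>
          Complex.exp (diagPrim t₀ (P t₀ A B F) j t))ᴴ = 1 := by
      have d0 := damp_mul_exp t₀ (P t₀ A B F) 0 t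
      have d1 := damp_mul_exp t₀ (P t₀ A B F) 1 t
      ext i j
      fin_cases i <;> fin_cases j <;>
        simp [GaugedSystem.cB, GaugeData.system, Matrix.mul_apply, Matrix.diagonal_apply]
      · linear_combination d0
      · linear_combination d1
    rw [gaugeFactor_eq_mul t₀ B _ ht0, Matrix.conjTranspose_mul, (isHermitian_sqrtB B t).eq,
      max_eq_left ht0]
    calc B t = sqrtB B t * 1 * sqrtB B t := by rw [mul_one, sqrtB_mul_self (hBpos t ht0)]
      _ = _ := by rw [← hD]; noncomm_ring
  eq_Q t ht := by
    have ht0 := hT.le.trans ht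
    have hq := h.hermq t ht0
    have e1 : (gaugeFactor t₀ B (P t₀ A B F) t)ᴴ * C (max t t₀) *
        gaugeFactor t₀ B (P t₀ A B F) t =
        (Matrix.diagonal fun j => Complex.exp (diagPrim t₀ (P t₀ A B F) j t))ᴴ * Q B C t *
          Matrix.diagonal fun j => Complex.exp (diagPrim t₀ (P t₀ A B F) j t) := by
      rw [gaugeFactor_eq_mul t₀ B _ ht0, Matrix.conjTranspose_mul, (isHermitian_sqrtB B t).eq,
        max_eq_left ht0, Q]
      noncomm_ring
    rw [e1]
    have h00 : Q B C t 0 0 = ((Q B C t 0 0).re : ℂ) :=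
      (Complex.conj_eq_iff_re.1 (hq.apply 0 0)).symm
    have h11 : Q B C t 1 1 = ((Q B C t 1 1).re : ℂ) :=
      (Complex.conj_eq_iff_re.1 (hq.apply 1 1)).symm
    have h10 : Q B C t 1 0 = conj (Q B C t 0 1) := (hq.apply 1 0).symm
    ext i j
    rw [Matrix.mul_diagonal, Matrix.diagonal_conjTranspose, Matrix.diagonal_mul]
    fin_cases i <;> fin_cases j <;>
      simp [GaugedSystem.cQ, GaugeData.system, max_eq_left ht0, expTrace_eq_mul]
    · rw [h00, ← Complex.ofReal_pow, ← Complex.normSq_eq_norm_sq, ← Complex.mul_conj]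
      simp; ring
    · ring
    · rw [h10]; ring
    · rw [h11, ← Complex.ofReal_pow, ← Complex.normSq_eq_norm_sq, ← Complex.mul_conj]
      simp; ring

/-- An eventually nondegenerate conjoined solution makes the system non-oscillatory. -/
theorem isNonoscillatory_of_hasNonsingularConjoined
    (h : HasNonsingularConjoined (fun t => A (max t t₀)) (fun t => B (max t t₀))
      (fun t => C (max t t₀))) : IsNonoscillatory t₀ A B C := by
  obtain ⟨Φ, Ψ, T, hΦ, hΨ, hconj, hdet⟩ := h
  intro hosc
  obtain ⟨t, hTt, -, h0⟩ := hosc Φ Ψ (fun t ht i j => by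
    have h1 := hΦ t i j
    have h2 := hΨ t i j
    simp only [max_eq_left ht] at h1 h2
    exact ⟨h1.hasDerivWithinAt, h2.hasDerivWithinAt⟩) (fun t _ => hconj t) T
  exact hdet t hTt h0

end Ham

theorem theorem3p4 (t₀ : ℝ) (A B C F : ℝ → Mat2)
    (hA : Ham.ContEntries t₀ A) (hB : Ham.ContEntries t₀ B) (hC : Ham.ContEntries t₀ C)
    (hCherm : ∀ t, t₀ ≤ t → (C t).IsHermitian)
    (hBpos : ∀ t, t₀ ≤ t → (B t).PosSemidef)
    (hsqrt : Ham.C1Entries t₀ (Ham.sqrtB B))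
    (hF : Ham.SolvesFactorEq t₀ A B F)
    (hPdiag : ∀ j, ∀ T, t₀ ≤ T →
      IntervalIntegrable (fun t => Ham.P t₀ A B F t j j) volume t₀ T)
    (hp12 : ContDiffOn ℝ 1 (fun t => Ham.P t₀ A B F t 0 1) (Ici t₀))
    (hp21 : ContDiffOn ℝ 1 (fun t => Ham.P t₀ A B F t 1 0) (Ici t₀))
    (hcond3 : Ham.SeqCond t₀ (fun t => 2 * (Ham.P t₀ A B F t 0 0).re)
      (Ham.chi3 t₀ (Ham.P t₀ A B F) (Ham.Q B C)))
    (hcond4 : Ham.SeqCond t₀ (fun t => 2 * (Ham.P t₀ A B F t 1 1).re)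
      (Ham.chi4 t₀ (Ham.P t₀ A B F) (Ham.Q B C))) :
    Ham.IsNonoscillatory t₀ A B C := by
  have h := Ham.gaugeData_of_factor hC hCherm hsqrt hPdiag hp12 hp21
  obtain ⟨T, V, hT, hV⟩ := h.exists_riccati hcond3 hcond4
  exact Ham.isNonoscillatory_of_hasNonsingularConjoined
    ((Ham.isGauged h hA hB hC hCherm hBpos hsqrt hF hT).hasNonsingularConjoined hV)
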